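/- Let $n\ge 0$, let $\mathcal K^n$ be the family of nonempty convex compact subsets of $\mathbb R^n$ with the Hausdorff distance, and for a linear subspace $H$ of $\mathbb R^n$ let $R_H$ be the orthogonal reflection in $H$ and $(\mathcal K^n)_H=\{K\in\mathcal K^n : R_HK=K\}$. A symmetrization $\diamondsuit$ on $\mathcal K^n$ assigns to every linear subspace $H$ a map $\diamondsuit_H:\mathcal K^n\to(\mathcal K^n)_H$. Let $\mathcal F$ be the family of all symmetrizations $\diamondsuit$ on $\mathcal K^n$ such that, for every linear subspace $H$ and all $K,L\in\mathcal K^n$: (1) $K\subseteq L$ implies $\diamondsuit_HK\subseteq\diamondsuit_HL$; (2) if $R_HK=K$, then $\diamondsuit_H(K+x)=K$ for every $x\in H^\perp$; (3) if $R_HK=K$, then $\diamondsuit_HK=K$. A sequence $(H_m)$ of linear subspaces is called $\diamondsuit$-stable if, for every index $k$ and every $K\in\mathcal K^n$, the sequence $$\diamondsuit_{H_m}\cdots\diamondsuit_{H_{k+1}}\diamondsuit_{H_k}K,\qquad m\ge k,$$ converges in $\mathcal K^n$ (to a limit that may depend on $k$ and $K$). If $\diamondsuit\in\mathcal F$ and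 $(H_m)$ is a $\diamondsuit$-stable sequence of linear subspaces of $\mathbb R^n$, then $(H_m)$ is $\spadesuit$-stable for every $\spadesuit\in\mathcal F$. In particular, let $(H_m)$ be a sequence of hyperplanes (linear subspaces of dimension $n-1$). Then $(H_m)$ is stable for Steiner symmetrization if and only if it is stable for Minkowski symmetrization $M_HK=\tfrac12(K+R_HK)$; and, for every $\diamondsuit\in\mathcal F$, it is stable for Steiner symmetrization if and only if it is $\diamondsuit$-stable. Here the Steiner symmetral of $K$ with respect to $H$ is obtained by replacing every nonempty section $K\cap\ell$ by a line $\ell$ orthogonal to $H$ with the closed segment of $\ell$ (possibly a point) that has the same length and is centred at $\ell\cap H$. -/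

import Mathlib

open Set Filter Topology MeasureTheory
open scoped Pointwise

noncomputable section

namespace SymmProc

/-- The ambient Euclidean space `ℝⁿ`. -/
abbrev E (n : ℕ) : Type := EuclideanSpace ℝ (Fin n)

/-- `𝒦ⁿ`: nonempty convex compact subsets of `ℝⁿ`, a metric space under the Hausdorff distance
(nonempty interior is not required by Mathlib's `ConvexBody`). -/
abbrev KK (n : ℕ) : Type := ConvexBody (E n)

variable {n : ℕ}

/-- `A` is symmetric with respect to the linear subspace `H`: `R_H A = A`. -/
def IsHSymmetric (H : Submodule ℝ (E n)) (A : Set (E n)) : Prop :=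
  H.reflection '' A = A

/-- The translate `K + x`. -/
def translate (K : KK n) (x : E n) : KK n where
  carrier := (fun y => y + x) '' (K : Set (E n))
  convex' := by simpa only [add_comm] using K.convex.translate x
  isCompact' := K.isCompact.image (by fun_prop)
  nonempty' := K.nonempty.image _

/-- A symmetrization on `𝒦ⁿ`: for every linear subspace `H` a map from `𝒦ⁿ` to the
`H`-symmetric members of `𝒦ⁿ`. -/
structure Symmetrization (n : ℕ) where
  /-- The map `◇_H`. -/
  toFun : Submodule ℝ (E n) → KK n → KK n
  /-- `◇_H K` is `H`-symmetric. -/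
  symmetric' : ∀ (H : Submodule ℝ (E n)) (K : KK n), IsHSymmetric H (toFun H K : Set (E n))

/-- Monotonicity. -/
def IsMonotone (D : Symmetrization n) : Prop :=
  ∀ (H : Submodule ℝ (E n)) (K L : KK n), (K : Set (E n)) ⊆ (L : Set (E n)) →
    (D.toFun H K : Set (E n)) ⊆ (D.toFun H L : Set (E n))

/-- `Hᗮ`-translation invariance for `H`-symmetric sets. -/
def IsTranslationInvariant (D : Symmetrization n) : Prop :=
  ∀ (H : Submodule ℝ (E n)) (K : KK n), IsHSymmetric H (K : Set (E n)) →
    ∀ x ∈ Hᗮ, D.toFun H (translate K x) = K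

/-- Invariance for `H`-symmetric sets. -/
def IsInvariantOnSymmetric (D : Symmetrization n) : Prop :=
  ∀ (H : Submodule ℝ (E n)) (K : KK n), IsHSymmetric H (K : Set (E n)) → D.toFun H K = K

/-- The family `ℱ` of symmetrizations on `𝒦ⁿ`. -/
def familyF (n : ℕ) : Set (Symmetrization n) :=
  {D | IsMonotone D ∧ IsTranslationInvariant D ∧ IsInvariantOnSymmetric D}

/-- For a sequence of maps `T m : 𝒦ⁿ → 𝒦ⁿ`, the set `T_{k+j} ⋯ T_{k+1} T_k K`. -/
def process (T : ℕ → KK n → KK n) (k : ℕ) (K : KK n) : ℕ → KK n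
  | 0 => T k K
  | j + 1 => T (k + (j + 1)) (process T k K j)

/-- All truncated processes `(T_m ⋯ T_k K)_{m ≥ k}` converge in `𝒦ⁿ` in the Hausdorff distance.
The limit may depend on both `k` and `K`. -/
def IsStableProcess (T : ℕ → KK n → KK n) : Prop :=
  ∀ (k : ℕ) (K : KK n), ∃ L : KK n, Tendsto (process T k K) atTop (𝓝 L)

/-- The sequence of subspaces `(H_m)` is `◇`-stable. -/
def IsStable (D : Symmetrization n) (H : ℕ → Submodule ℝ (E n)) : Prop :=
  IsStableProcess fun m => D.toFun (H m)

/-- The Minkowski symmetral `(K + R_H K) / 2`. -/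
def minkowski (H : Submodule ℝ (E n)) (K : KK n) : KK n where
  carrier := (1 / 2 : ℝ) • ((K : Set (E n)) + H.reflection '' (K : Set (E n)))
  convex' := (K.convex.add
    (K.convex.linear_image H.reflection.toLinearEquiv.toLinearMap)).smul _
  isCompact' := (K.isCompact.add (K.isCompact.image H.reflection.continuous)).smul _
  nonempty' := (K.nonempty.add (K.nonempty.image _)).smul_set

/-- The section of `C` by the affine subspace through `y` orthogonal to `H`. -/
def orthSection (H : Submodule ℝ (E n)) (C : Set (E n)) (y : E n) : Set (E n) :=
  {z ∈ C | H.starProjection z = H.starProjection y}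

/-- The Steiner symmetral of `C` with respect to the hyperplane `H`: every nonempty section of `C`
by a line `ℓ` orthogonal to `H` is replaced by the closed segment of `ℓ` centred on `H` that has
the same length (a point, if the length is zero). -/
def steinerSet (H : Submodule ℝ (E n)) (C : Set (E n)) : Set (E n) :=
  {y | (orthSection H C y).Nonempty ∧
    ENNReal.ofReal (2 * dist y (H.starProjection y)) ≤ μH[1] (orthSection H C y)}

/-- For a hyperplane and a convex compact set, the Steiner symmetral consists of the points
`(p + R_H q) / 2`, where `p, q ∈ K` lie on a common line orthogonal to `H`. -/
theorem steinerSet_eq (H : Submodule ℝ (E n)) (hH : Module.finrank ℝ H + 1 = n) (K : KK n) :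
    steinerSet H (K : Set (E n)) =
      (fun z : E n × E n => (1 / 2 : ℝ) • (z.1 + H.reflection z.2)) ''
        {z | z ∈ (K : Set (E n)) ×ˢ (K : Set (E n)) ∧
          H.starProjection z.1 = H.starProjection z.2} := by
  have h1 : Module.finrank ℝ Hᗮ = 1 := by
    have := H.finrank_add_finrank_orthogonal
    rw [finrank_euclideanSpace_fin] at this
    omega
  obtain ⟨u₀, hu₀, hspan₀⟩ := finrank_eq_one_iff'.mp h1
  obtain ⟨u, huH, hun, hspan⟩ : ∃ u ∈ Hᗮ, ‖u‖ = 1 ∧ ∀ w ∈ Hᗮ, ∃ t : ℝ, w = t • u := by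
    have hne : ‖(u₀ : E n)‖ ≠ 0 := by simpa using hu₀
    refine ⟨‖(u₀ : E n)‖⁻¹ • (u₀ : E n), Hᗮ.smul_mem _ u₀.2, ?_, fun w hw => ?_⟩
    · rw [norm_smul, norm_inv, norm_norm, inv_mul_cancel₀ hne]
    · obtain ⟨c, hc⟩ := hspan₀ ⟨w, hw⟩
      refine ⟨c * ‖(u₀ : E n)‖, ?_⟩
      rw [smul_smul, mul_assoc, mul_inv_cancel₀ hne, mul_one]
      exact (congrArg Subtype.val hc).symm
  have hPu : H.starProjection u = 0 :=
    (Submodule.starProjection_apply_eq_zero_iff H).mpr huH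
  have hPP : ∀ y, H.starProjection (H.starProjection y) = H.starProjection y := fun y =>
    Submodule.starProjection_eq_self_iff.mpr (Submodule.starProjection_apply_mem H y)
  have hdec : ∀ y, ∃ t : ℝ, y = H.starProjection y + t • u := fun y => by
    obtain ⟨t, ht⟩ := hspan (y - H.starProjection y)
      (Submodule.sub_starProjection_mem_orthogonal y)
    exact ⟨t, by rw [← ht]; abel⟩
  have hP : ∀ (y : E n) (t : ℝ), H.starProjection (H.starProjection y + t • u) =
      H.starProjection y := fun y t => by rw [map_add, map_smul, hPu, hPP]; simp
  ext y
  set x := H.starProjection y with hx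
  set f : ℝ → E n := fun t => x + t • u with hf
  have hfiso : Isometry f := by
    refine Isometry.of_dist_eq fun s t => ?_
    simp only [hf, dist_eq_norm, add_sub_add_left_eq_sub, ← sub_smul, norm_smul, hun, mul_one]
  have hsec : orthSection H (K : Set (E n)) y = f '' (f ⁻¹' (K : Set (E n))) := by
    ext z
    constructor
    · rintro ⟨hz, hzx⟩
      obtain ⟨t, ht⟩ := hdec z
      rw [hzx] at ht
      exact ⟨t, by simpa only [Set.mem_preimage, hf, hx, ← ht] using hz, ht.symm⟩
    · rintro ⟨t, ht, rfl⟩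
      exact ⟨ht, hP y t⟩
  obtain ⟨s, hs⟩ := hdec y
  have hys : y = f s := hs
  have hdist : dist y x = |s| := by
    rw [hys, hf, dist_eq_norm, add_sub_cancel_left, norm_smul, hun, mul_one, Real.norm_eq_abs]
  have hR : ∀ t, H.reflection (f t) = f (-t) := fun t => by
    rw [Submodule.reflection_apply, hf]
    simp only [hx, hP]
    module
  have hmid : ∀ a b : ℝ, (1 / 2 : ℝ) • (f a + f b) = f ((a + b) / 2) := fun a b => by
    simp only [hf]; module
  have hrhs : y ∈ (fun z : E n × E n => (1 / 2 : ℝ) • (z.1 + H.reflection z.2)) ''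
        {z | z ∈ (K : Set (E n)) ×ˢ (K : Set (E n)) ∧
          H.starProjection z.1 = H.starProjection z.2} ↔
      ∃ a b : ℝ, f a ∈ (K : Set (E n)) ∧ f b ∈ (K : Set (E n)) ∧ s = (a - b) / 2 := by
    constructor
    · rintro ⟨⟨p, q⟩, ⟨⟨hp, hq⟩, hpq⟩, hy⟩
      simp only at hp hq hpq hy
      have hxp : H.starProjection p = x := by
        rw [hx, ← hy, map_smul, map_add, Submodule.reflection_apply, map_sub, map_nsmul, hPP, hpq]
        module
      obtain ⟨a, ha⟩ := hdec p
      obtain ⟨b, hb⟩ := hdec q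
      rw [hxp] at ha
      rw [← hpq, hxp] at hb
      have ha' : p = f a := ha
      have hb' : q = f b := hb
      refine ⟨a, b, ha' ▸ hp, hb' ▸ hq, hfiso.injective ?_⟩
      rw [← hys, ← hy, ha', hb', hR, hmid, sub_eq_add_neg]
    · rintro ⟨a, b, ha, hb, hab⟩
      refine ⟨(f a, f b), ⟨⟨ha, hb⟩, ?_⟩, ?_⟩
      · simp only [hf, hx, hP]
      · simp only [hR, hmid]
        rw [hys, hab, sub_eq_add_neg]
  rw [hrhs]
  change ((orthSection H (K : Set (E n)) y).Nonempty ∧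
    ENNReal.ofReal (2 * dist y x) ≤ μH[1] (orthSection H (K : Set (E n)) y)) ↔ _
  rw [hdist, hsec, Set.image_nonempty,
    hfiso.hausdorffMeasure_image (Or.inl zero_le_one), hausdorffMeasure_real]
  by_cases hne : (f ⁻¹' (K : Set (E n))).Nonempty
  swap
  · refine ⟨fun h => absurd h.1 hne, ?_⟩
    rintro ⟨a, b, ha, -⟩
    exact absurd ⟨a, ha⟩ hne
  have hcpt : IsCompact (f ⁻¹' (K : Set (E n))) :=
    hfiso.isClosedEmbedding.isCompact_preimage K.isCompact
  have hcvx : Convex ℝ (f ⁻¹' (K : Set (E n))) := by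
    intro a ha b hb c d hc hd hcd
    have := K.convex ha hb hc hd hcd
    rw [Set.mem_preimage]
    convert this using 1
    have e : x = c • x + d • x := by rw [← add_smul, hcd, one_smul]
    simp only [hf, smul_eq_mul]
    nth_rewrite 1 [e]
    module
  obtain ⟨a, b, hI⟩ : ∃ a b, f ⁻¹' (K : Set (E n)) = Icc a b :=
    ⟨_, _, eq_Icc_of_connected_compact ⟨hne, hcvx.isPreconnected⟩ hcpt⟩
  have hmem : ∀ t, f t ∈ (K : Set (E n)) ↔ t ∈ Icc a b := fun t => by
    rw [← hI, Set.mem_preimage]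
  simp only [hmem]
  rw [hI] at hne ⊢
  have hab : a ≤ b := Set.nonempty_Icc.mp hne
  rw [Real.volume_Icc, ENNReal.ofReal_le_ofReal_iff (sub_nonneg.mpr hab)]
  constructor
  · rintro ⟨-, h⟩
    have h' := abs_le.mp (show |s| ≤ (b - a) / 2 by linarith)
    exact ⟨(a + b) / 2 + s, (a + b) / 2 - s, ⟨by linarith, by linarith⟩,
      ⟨by linarith, by linarith⟩, by ring⟩
  · rintro ⟨p, q, hp, hq, rfl⟩
    refine ⟨hne, ?_⟩
    have : |(p - q) / 2| ≤ (b - a) / 2 :=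
      abs_le.mpr ⟨by linarith [hp.1, hq.2], by linarith [hp.2, hq.1]⟩
    linarith

/-- Steiner symmetrization with respect to a hyperplane, as a map on `𝒦ⁿ`. -/
def steiner (H : Submodule ℝ (E n)) (hH : Module.finrank ℝ H + 1 = n) (K : KK n) : KK n where
  carrier := steinerSet H (K : Set (E n))
  convex' := by
    rw [steinerSet_eq H hH K]
    rintro _ ⟨⟨p, q⟩, ⟨⟨hp, hq⟩, hpq⟩, rfl⟩ _ ⟨⟨p', q'⟩, ⟨⟨hp', hq'⟩, hpq'⟩, rfl⟩ c d hc hd hcd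
    refine ⟨(c • p + d • p', c • q + d • q'),
      ⟨⟨K.convex hp hp' hc hd hcd, K.convex hq hq' hc hd hcd⟩, ?_⟩, ?_⟩
    · simp only at hpq hpq'
      simp only [map_add, map_smul, hpq, hpq']
    · simp only [map_add, map_smul]
      module
  isCompact' := by
    rw [steinerSet_eq H hH K]
    refine IsCompact.image ?_ ?_
    · exact (K.isCompact.prod K.isCompact).inter_right (isClosed_eq
        (H.starProjection.continuous.comp continuous_fst)
        (H.starProjection.continuous.comp continuous_snd))
    · have h : Continuous fun z : E n × E n => z.1 + H.reflection z.2 :=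
        continuous_fst.add (H.reflection.continuous.comp continuous_snd)
      exact h.const_smul (1 / 2 : ℝ)
  nonempty' := by
    rw [steinerSet_eq H hH K]
    obtain ⟨p, hp⟩ := K.nonempty
    exact ⟨_, (p, p), ⟨⟨hp, hp⟩, rfl⟩, rfl⟩

end SymmProc

end

/-! Minkowski symmetrization serves as a pivot: stability of every process in question is equivalent
to stability of the Minkowski process along the same subspaces. All that is used of a symmetrization
is a sandwich (`IsSandwiched`): its value contains every `(p + R_H q) / 2` with `p, q ∈ K` in one
fibre orthogonal to `H`, and lies in `M_H K`. Members of `ℱ` satisfy this by comparison with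
translates of `H`-symmetric sets (`isSandwiched_of_mem_familyF`), and Steiner symmetrization
satisfies it by its midpoint description.

From Minkowski to `T` (`isStableProcess_of_minkowski`): the integral of the support function over
the sphere is invariant under `M_H`, so it decreases along the `T`-process. Once little is left to
lose, the Minkowski process restarted from the current body contains the `T`-process and stays
`L¹`-close to it. Since the former converges, the latter is `L¹`-Cauchy. The bodies are uniformly
bounded, so the support functions are equi-Lipschitz and `L¹`-closeness is Hausdorff closeness.

From `T` to Minkowski (`isStableProcess_minkowski_of_isSandwiched`): linearize at the unit ball `B`.
On `B + εL` the Minkowski process has support function `1 + ε h`, with `h` that of the process on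
`L`. The two processes started at `B + εL` differ by `O(ε²)` in `L¹`, uniformly in time
(`exists_l1Dist_process_le`): `T` does not decrease volume, by Brunn–Minkowski on fibres; `M_H` does
not increase `∫ h ^ n`, by convexity; always `n · vol ≤ ∫ h ^ n`, and at `B + εL` this is an
equality up to `O(ε²)`. Dividing by `ε`, the process on `L` is Cauchy up to `O(ε)`, with `ε`
arbitrary. -/

open scoped ENNReal

/-! ### Brunn–Minkowski and Prékopa–Leindler on the line -/

/-- One-dimensional Brunn–Minkowski inequality, midpoint form. -/
theorem volume_add_volume_le_two_mul_of_midpoint {A B C : Set ℝ} (hA : MeasurableSet A)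
    (hB : MeasurableSet B) (hA0 : A.Nonempty) (hB0 : B.Nonempty)
    (h : ∀ x ∈ A, ∀ y ∈ B, (x + y) / 2 ∈ C) : volume A + volume B ≤ 2 * volume C := by
  have key : ∀ K ⊆ A, IsCompact K → ∀ L ⊆ B, IsCompact L →
      volume K + volume L ≤ 2 * volume C := by
    intro K hKA hK L hLB hL
    obtain ⟨a₀, ha₀⟩ := hA0
    obtain ⟨b₀, hb₀⟩ := hB0
    wlog hne : K.Nonempty ∧ L.Nonempty generalizing K L
    · refine le_trans ?_ (this (insert a₀ K) (insert_subset ha₀ hKA) (hK.insert a₀)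
        (insert b₀ L) (insert_subset hb₀ hLB) (hL.insert b₀)
        ⟨insert_nonempty _ _, insert_nonempty _ _⟩)
      gcongr <;> exact subset_insert _ _
    -- With `a = max K` and `b = min L`, the sets `(K + b) / 2` and `(a + L) / 2` lie in `C` on
    -- opposite sides of `(a + b) / 2`, so their measures add up.
    obtain ⟨a, haK, ha⟩ := hK.exists_isGreatest hne.1
    obtain ⟨b, hbL, hb⟩ := hL.exists_isLeast hne.2
    have half : ∀ (c : ℝ) (S : Set ℝ), volume ((fun x => (x + c) / 2) '' S) = 2⁻¹ * volume S := by
      intro c S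
      have : (fun x : ℝ => (x + c) / 2) '' S = (2⁻¹ : ℝ) • ((fun x => x + c) '' S) := by
        rw [← image_smul, image_image]
        simp only [smul_eq_mul, div_eq_inv_mul]
      rw [this, Measure.addHaar_smul]
      simp [abs_of_pos]
    have h1 : 2⁻¹ * volume K ≤ volume (C ∩ Iic ((a + b) / 2)) := by
      rw [← half b K]
      refine measure_mono ?_
      rintro _ ⟨x, hx, rfl⟩
      refine ⟨h x (hKA hx) b (hLB hbL), ?_⟩
      have := ha hx
      simp only [mem_Iic]; linarith
    have h2 : 2⁻¹ * volume L ≤ volume (C ∩ Ioi ((a + b) / 2)) := by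
      rw [← half a L]
      have : volume ((fun x => (x + a) / 2) '' L) ≤
          volume ((C ∩ Ioi ((a + b) / 2)) ∪ {(a + b) / 2}) := by
        refine measure_mono ?_
        rintro _ ⟨x, hx, rfl⟩
        have hbx := hb hx
        have hm := h a (hKA haK) x (hLB hx)
        rw [add_comm] at hm
        rcases hbx.eq_or_lt with e | e
        · right; simp [e, add_comm]
        · left; exact ⟨hm, by simp only [mem_Ioi]; linarith⟩
      refine this.trans ((measure_union_le _ _).trans ?_)
      simp
    have h3 : volume (C ∩ Iic ((a + b) / 2)) + volume (C ∩ Ioi ((a + b) / 2)) = volume C := by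
      rw [← measure_inter_add_sdiff C (measurableSet_Iic (a := (a + b) / 2)), sdiff_eq, compl_Iic]
    calc volume K + volume L = 2 * (2⁻¹ * volume K + 2⁻¹ * volume L) := by
          rw [mul_add, ← mul_assoc, ← mul_assoc, ENNReal.mul_inv_cancel (by simp) (by simp)]
          simp
      _ ≤ 2 * volume C := by rw [← h3]; gcongr
  rw [hA.measure_eq_iSup_isCompact, hB.measure_eq_iSup_isCompact]
  simp only [iSup_and']
  exact ENNReal.biSup_add_biSup_le' ⟨∅, empty_subset _, isCompact_empty⟩
    ⟨∅, empty_subset _, isCompact_empty⟩ fun K hK L hL => key K hK.1 hK.2 L hL.1 hL.2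

theorem ENNReal.mul_le_sq_of_add_le_two_mul {a b c : ℝ≥0∞} (h : a + b ≤ 2 * c) :
    a * b ≤ c ^ 2 := by
  by_cases hc : c = ∞
  · simp [hc]
  have hab : a + b ≠ ∞ := ne_top_of_le_ne_top (ENNReal.mul_ne_top (by simp) hc) h
  obtain ⟨ha, hb⟩ := ENNReal.add_ne_top.mp hab
  lift a to NNReal using ha
  lift b to NNReal using hb
  lift c to NNReal using hc
  norm_cast at h ⊢
  rw [← NNReal.coe_le_coe] at h ⊢
  push_cast at h ⊢
  nlinarith [sq_nonneg ((a : ℝ) - b), a.2, b.2, c.2]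

/-- Normalised real-valued one-dimensional Prékopa–Leindler inequality, additive form. -/
theorem lintegral_add_le_two_mul_of_midpoint {f g h : ℝ → ℝ} (hf : Measurable f)
    (hg : Measurable g) (hh : Measurable h) (hf0 : ∀ x, 0 ≤ f x) (hg0 : ∀ x, 0 ≤ g x)
    (hh0 : ∀ x, 0 ≤ h x) (hf1 : ∀ x, f x ≤ 1) (hg1 : ∀ x, g x ≤ 1)
    (hfs : ∀ t < 1, ∃ x, t < f x) (hgs : ∀ t < 1, ∃ x, t < g x)
    (hfgh : ∀ x y, f x * g y ≤ h ((x + y) / 2) ^ 2) :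
    (∫⁻ x, ENNReal.ofReal (f x)) + ∫⁻ x, ENNReal.ofReal (g x) ≤
      2 * ∫⁻ x, ENNReal.ofReal (h x) := by
  rw [lintegral_eq_lintegral_meas_lt volume (ae_of_all _ hf0) hf.aemeasurable,
    lintegral_eq_lintegral_meas_lt volume (ae_of_all _ hg0) hg.aemeasurable,
    lintegral_eq_lintegral_meas_lt volume (ae_of_all _ hh0) hh.aemeasurable]
  have anti : ∀ k : ℝ → ℝ, Measurable fun t : ℝ => volume {a | t < k a} := fun k =>
    Antitone.measurable fun s t hst => measure_mono fun x hx => lt_of_le_of_lt hst hx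
  rw [← lintegral_add_left (anti f), ← lintegral_const_mul _ (anti h)]
  refine setLIntegral_mono ((anti h).const_mul _) fun t ht => ?_
  -- Layer cake: for `t < 1` the superlevel sets of `f` and `g` are both nonempty, which is what
  -- Brunn–Minkowski needs; for `t ≥ 1` they are empty.
  rcases lt_or_ge t 1 with h1 | h1
  · refine volume_add_volume_le_two_mul_of_midpoint (hf measurableSet_Ioi) (hg measurableSet_Ioi)
      (hfs t h1) (hgs t h1) fun x hx y hy => ?_
    have hx' : t < f x := hx
    have hy' : t < g y := hy
    have ht' : 0 < t := ht
    refine lt_of_pow_lt_pow_left₀ 2 (hh0 _) (lt_of_lt_of_le ?_ (hfgh x y))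
    nlinarith
  · have e : ∀ k : ℝ → ℝ, (∀ x, k x ≤ 1) → {a | t < k a} = ∅ := fun k hk =>
      eq_empty_of_forall_notMem fun x hx => absurd (hx.trans_le (hk x)) (not_lt.mpr h1)
    simp [e f hf1, e g hg1]

/-! ### Prékopa–Leindler in Euclidean spaces -/

/-- The midpoint Prékopa–Leindler inequality for the measure `μ`. -/
def MidpointPrekopaLeindler {V : Type*} [AddCommGroup V] [Module ℝ V] [MeasurableSpace V]
    (μ : Measure V) : Prop :=
  ∀ f g h : V → ℝ≥0∞, Measurable f → Measurable g → Measurable h →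
    (∀ x y, f x * g y ≤ h ((1 / 2 : ℝ) • (x + y)) ^ 2) →
    (∫⁻ x, f x ∂μ) * ∫⁻ x, g x ∂μ ≤ (∫⁻ x, h x ∂μ) ^ 2

/-- For bounded `f` and `g`, dividing by the suprema `a`, `b` (and `h` by their geometric mean)
reduces to the normalised additive inequality, and AM–GM makes it multiplicative. Unbounded
functions follow by truncation. -/
theorem midpointPrekopaLeindler_real : MidpointPrekopaLeindler (volume : Measure ℝ) := by
  have bdd : ∀ f g h : ℝ → ℝ≥0∞, Measurable f → Measurable g → Measurable h →
      (⨆ x, f x) ≠ ∞ → (⨆ x, g x) ≠ ∞ →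
      (∀ x y, f x * g y ≤ h ((1 / 2 : ℝ) • (x + y)) ^ 2) →
      (∫⁻ x, f x) * ∫⁻ x, g x ≤ (∫⁻ x, h x) ^ 2 := by
    intro f g h hf hg hh hfb hgb hfgh
    set a := ⨆ x, f x with ha
    set b := ⨆ x, g x with hb
    have hfa : ∀ x, f x ≤ a := le_iSup f
    have hgb' : ∀ x, g x ≤ b := le_iSup g
    rcases eq_or_ne a 0 with ha0 | ha0
    · have : ∀ x, f x = 0 := fun x => le_antisymm (ha0 ▸ hfa x) bot_le
      simp [this]
    rcases eq_or_ne b 0 with hb0 | hb0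
    · have : ∀ x, g x = 0 := fun x => le_antisymm (hb0 ▸ hgb' x) bot_le
      simp [this]
    set c := (a * b) ^ (1 / 2 : ℝ) with hc
    have hab : a * b ≠ ∞ := ENNReal.mul_ne_top hfb hgb
    have hab0 : a * b ≠ 0 := mul_ne_zero ha0 hb0
    have hc2 : c ^ 2 = a * b := by
      rw [hc, ← ENNReal.rpow_natCast, ← ENNReal.rpow_mul]; norm_num
    have hsc : ∀ x y : ℝ≥0∞, x / a * (y / b) = x * y / c ^ 2 := fun x y => by
      rw [hc2, div_eq_mul_inv, div_eq_mul_inv, div_eq_mul_inv,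
        ENNReal.mul_inv (Or.inl ha0) (Or.inl hfb)]
      ring
    have hle1 : ∀ {x a : ℝ≥0∞}, x ≤ a → x / a ≤ 1 := fun hx => ENNReal.div_le_of_le_mul (by simpa)
    have hf1 : ∀ x, f x / a ≤ 1 := fun x => hle1 (hfa x)
    have hg1 : ∀ x, g x / b ≤ 1 := fun x => hle1 (hgb' x)
    have htop : ∀ {x : ℝ≥0∞}, x ≤ 1 → x ≠ ∞ := fun hx => ne_top_of_le_ne_top (by simp) hx
    have hsup : ∀ (k : ℝ → ℝ≥0∞) (s : ℝ≥0∞), s = ⨆ x, k x → s ≠ ∞ → s ≠ 0 →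
        (∀ x, k x / s ≤ 1) → ∀ t < (1 : ℝ), ∃ x, t < (k x / s).toReal := by
      intro k s hs hst hs0 hk t ht
      rcases lt_or_ge t 0 with h0 | h0
      · exact ⟨0, h0.trans_le ENNReal.toReal_nonneg⟩
      have : ENNReal.ofReal t * s < ⨆ x, k x := by
        rw [← hs]
        calc ENNReal.ofReal t * s < 1 * s := by
              refine ENNReal.mul_lt_mul_left hs0 hst ?_
              rwa [ENNReal.ofReal_lt_one]
          _ = s := one_mul s
      obtain ⟨x, hx⟩ := lt_iSup_iff.mp this
      refine ⟨x, ?_⟩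
      rw [← ENNReal.ofReal_lt_iff_lt_toReal h0 (htop (hk x))]
      rwa [ENNReal.lt_div_iff_mul_lt (Or.inl hs0) (Or.inl hst)]
    -- Capping `h / c` at `1` makes it real-valued and costs nothing, because the product of the
    -- normalised `f` and `g` is at most `1`.
    have main := lintegral_add_le_two_mul_of_midpoint
      (f := fun x => (f x / a).toReal) (g := fun x => (g x / b).toReal)
      (h := fun x => (min 1 (h x / c)).toReal)
      (hf.div_const a).ennreal_toReal (hg.div_const b).ennreal_toReal
      (measurable_const.min (hh.div_const c)).ennreal_toReal
      (fun _ => ENNReal.toReal_nonneg) (fun _ => ENNReal.toReal_nonneg)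
      (fun _ => ENNReal.toReal_nonneg)
      (fun x => ENNReal.toReal_le_of_le_ofReal zero_le_one (by simpa using hf1 x))
      (fun x => ENNReal.toReal_le_of_le_ofReal zero_le_one (by simpa using hg1 x))
      (hsup f a ha hfb ha0 hf1) (hsup g b hb hgb hb0 hg1) (fun x y => by
        rw [← ENNReal.toReal_mul, ← ENNReal.toReal_pow]
        refine ENNReal.toReal_mono (ENNReal.pow_ne_top (htop (min_le_left _ _))) ?_
        have e : (x + y) / 2 = (1 / 2 : ℝ) • (x + y) := by simp; ring
        rcases min_choice 1 (h ((x + y) / 2) / c) with hm | hm <;> rw [hm]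
        · simpa using mul_le_mul' (hf1 x) (hg1 y)
        · rw [hsc, e, div_eq_mul_inv _ c, mul_pow, ← ENNReal.inv_pow, div_eq_mul_inv]
          gcongr
          exact hfgh x y)
    simp only [ENNReal.ofReal_toReal (htop (hf1 _)), ENNReal.ofReal_toReal (htop (hg1 _)),
      ENNReal.ofReal_toReal (htop (min_le_left _ _))] at main
    have main2 := ENNReal.mul_le_sq_of_add_le_two_mul (main.trans (mul_le_mul_right
      (lintegral_mono fun x => min_le_right 1 (h x / c)) 2))
    simp only [div_eq_mul_inv] at main2
    rw [lintegral_mul_const _ hf, lintegral_mul_const _ hg, lintegral_mul_const _ hh,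
      ← div_eq_mul_inv, ← div_eq_mul_inv, hsc, mul_pow, ← ENNReal.inv_pow, ← div_eq_mul_inv,
      hc2] at main2
    calc (∫⁻ x, f x) * ∫⁻ x, g x = ((∫⁻ x, f x) * ∫⁻ x, g x) / (a * b) * (a * b) :=
          (ENNReal.div_mul_cancel hab0 hab).symm
      _ ≤ (∫⁻ x, h x) ^ 2 / (a * b) * (a * b) := by gcongr
      _ = (∫⁻ x, h x) ^ 2 := ENNReal.div_mul_cancel hab0 hab
  intro f g h hf hg hh hfgh
  have trunc : ∀ k : ℝ → ℝ≥0∞, Measurable k → ∫⁻ x, k x = ⨆ N : ℕ, ∫⁻ x, min (k x) N := by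
    intro k hk
    rw [← lintegral_iSup (fun N => hk.min measurable_const)
      fun i j hij x => min_le_min_left _ (by exact_mod_cast hij)]
    refine lintegral_congr fun x => ?_
    rw [← inf_iSup_eq, ENNReal.iSup_natCast, inf_top_eq]
  have hlt : ∀ (k : ℝ → ℝ≥0∞) (N : ℕ), (⨆ x, min (k x) N) ≠ ∞ := fun k N =>
    ne_top_of_le_ne_top (ENNReal.natCast_ne_top N) (iSup_le fun x => min_le_right _ _)
  rw [trunc f hf, trunc g hg, ENNReal.iSup_mul]
  refine iSup_le fun i => ?_
  rw [ENNReal.mul_iSup]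
  exact iSup_le fun j => bdd _ _ h (hf.min measurable_const) (hg.min measurable_const) hh
    (hlt f i) (hlt g j) fun x y => (mul_le_mul' (min_le_left _ _) (min_le_left _ _)).trans
      (hfgh x y)

/-- Tensorization: the inequality for `ν` on fibres is precisely the hypothesis needed to apply the
inequality for `μ` to the marginals. -/
theorem MidpointPrekopaLeindler.prod {V W : Type*} [AddCommGroup V] [Module ℝ V]
    [MeasurableSpace V] [AddCommGroup W] [Module ℝ W] [MeasurableSpace W] {μ : Measure V}
    {ν : Measure W} [SFinite ν] (hμ : MidpointPrekopaLeindler μ)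
    (hν : MidpointPrekopaLeindler ν) : MidpointPrekopaLeindler (μ.prod ν) := by
  intro f g h hf hg hh hfgh
  rw [lintegral_prod _ hf.aemeasurable, lintegral_prod _ hg.aemeasurable,
    lintegral_prod _ hh.aemeasurable]
  refine hμ _ _ _ hf.lintegral_prod_right' hg.lintegral_prod_right' hh.lintegral_prod_right'
    fun x y => ?_
  refine hν _ _ _ (hf.comp measurable_prodMk_left) (hg.comp measurable_prodMk_left)
    (hh.comp measurable_prodMk_left) fun s t => ?_
  exact hfgh (x, s) (y, t)

theorem MidpointPrekopaLeindler.of_measurePreserving {V W : Type*} [AddCommGroup V] [Module ℝ V]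
    [MeasurableSpace V] [AddCommGroup W] [Module ℝ W] [MeasurableSpace W] {μ : Measure V}
    {ν : Measure W} (hμ : MidpointPrekopaLeindler μ) (e : V →ₗ[ℝ] W)
    (he : MeasurePreserving e μ ν) : MidpointPrekopaLeindler ν := by
  intro f g h hf hg hh hfgh
  rw [← he.lintegral_comp hf, ← he.lintegral_comp hg, ← he.lintegral_comp hh]
  refine hμ _ _ _ (hf.comp he.measurable) (hg.comp he.measurable) (hh.comp he.measurable)
    fun x y => ?_
  simpa using hfgh (e x) (e y)

theorem midpointPrekopaLeindler_pi (d : ℕ) :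
    MidpointPrekopaLeindler (volume : Measure (Fin d → ℝ)) := by
  induction d with
  | zero =>
    intro f g h _ _ _ hfgh
    have e : ∀ k : (Fin 0 → ℝ) → ℝ≥0∞, ∫⁻ x, k x = k 0 := fun k => by
      rw [volume_pi, Measure.pi_of_empty _ 0, lintegral_dirac]
    rw [e, e, e]
    simpa using hfgh 0 0
  | succ d ih =>
    refine (midpointPrekopaLeindler_real.prod ih).of_measurePreserving
      (Fin.consLinearEquiv ℝ (fun _ : Fin (d + 1) => ℝ)).toLinearMap ?_
    have e : ⇑(Fin.consLinearEquiv ℝ (fun _ : Fin (d + 1) => ℝ)).toLinearMap =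
        ⇑(MeasurableEquiv.piFinSuccAbove (fun _ : Fin (d + 1) => ℝ) 0).symm := by
      funext x i
      refine Fin.cases ?_ (fun j => ?_) i <;> rfl
    rw [e]
    exact (volume_preserving_piFinSuccAbove (fun _ : Fin (d + 1) => ℝ) 0).symm

theorem midpointPrekopaLeindler_volume (V : Type*) [NormedAddCommGroup V] [InnerProductSpace ℝ V]
    [FiniteDimensional ℝ V] [MeasurableSpace V] [BorelSpace V] :
    MidpointPrekopaLeindler (volume : Measure V) := by
  have h1 : MidpointPrekopaLeindler
      (volume : Measure (EuclideanSpace ℝ (Fin (Module.finrank ℝ V)))) :=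
    (midpointPrekopaLeindler_pi _).of_measurePreserving
      (WithLp.linearEquiv 2 ℝ (Fin (Module.finrank ℝ V) → ℝ)).symm.toLinearMap
      (PiLp.volume_preserving_toLp _)
  exact h1.of_measurePreserving (stdOrthonormalBasis ℝ V).repr.symm.toLinearEquiv.toLinearMap
    (stdOrthonormalBasis ℝ V).measurePreserving_repr_symm

/-! ### Volume growth under fibrewise symmetrization -/

section FiberVolume

variable {V : Type*} [NormedAddCommGroup V] [InnerProductSpace ℝ V]
  [FiniteDimensional ℝ V] [MeasurableSpace V] [BorelSpace V]

/-- Brunn–Minkowski for the difference body. -/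
theorem volume_le_of_half_sub_mem {A D : Set V} (hA : MeasurableSet A) (hD : MeasurableSet D)
    (h : ∀ x ∈ A, ∀ y ∈ A, (1 / 2 : ℝ) • (x - y) ∈ D) : volume A ≤ volume D := by
  have key := midpointPrekopaLeindler_volume V (A.indicator 1) ((-A).indicator 1)
    (D.indicator 1) (measurable_one.indicator hA) (measurable_one.indicator hA.neg)
    (measurable_one.indicator hD) (fun x y => by
      by_cases hx : x ∈ A
      · by_cases hy : y ∈ -A
        · have := h x hx (-y) hy
          rw [sub_neg_eq_add] at this
          rw [indicator_of_mem hx, indicator_of_mem hy, indicator_of_mem this]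
          simp
        · simp [indicator_of_notMem hy]
      · simp [indicator_of_notMem hx])
  rw [lintegral_indicator_one hA, lintegral_indicator_one hA.neg, lintegral_indicator_one hD,
    Measure.measure_neg, ← sq] at key
  by_contra! hlt
  exact absurd key (not_le.mpr (ENNReal.pow_lt_pow_left two_ne_zero hlt))

/-- On a fibre `x + Hᗮ` the reflection is negation, so the section of `D` contains half the
difference set of the section of `K`. The difference-body inequality and Fubini conclude. -/
theorem volume_le_of_fiberwise_half_sub_mem {H : Submodule ℝ V} {K D : Set V}
    (hK : MeasurableSet K) (hD : MeasurableSet D)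
    (h : ∀ p ∈ K, ∀ q ∈ K, H.starProjection p = H.starProjection q →
      (1 / 2 : ℝ) • (p + H.reflection q) ∈ D) : volume K ≤ volume D := by
  let φ : (H × Hᗮ) ≃ₗ[ℝ] V := H.prodEquivOfIsCompl Hᗮ H.isCompl_orthogonal
  let φ' : (H × Hᗮ) ≃L[ℝ] V := φ.toContinuousLinearEquiv
  have hφ : ∀ z, φ' z = z.1 + z.2 := fun z =>
    Submodule.coe_prodEquivOfIsCompl' _ _ H.isCompl_orthogonal z
  let ν : Measure V := ((volume : Measure H).prod (volume : Measure Hᗮ)).map φ'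
  have : ν.IsAddHaarMeasure := φ'.isAddHaarMeasure_map _
  have hm : MeasurableEmbedding φ' := φ'.toHomeomorph.measurableEmbedding
  have hν : ν K ≤ ν D := by
    rw [hm.map_apply, hm.map_apply, Measure.prod_apply (φ'.continuous.measurable hK),
      Measure.prod_apply (φ'.continuous.measurable hD)]
    refine lintegral_mono fun x => ?_
    refine volume_le_of_half_sub_mem (measurable_prodMk_left (φ'.continuous.measurable hK))
      (measurable_prodMk_left (φ'.continuous.measurable hD)) ?_
    intro s hs t ht
    simp only [mem_preimage, hφ] at hs ht ⊢
    have pr : ∀ s : Hᗮ, H.starProjection ((x : V) + s) = x := fun s => by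
      rw [map_add, (Submodule.starProjection_apply_eq_zero_iff H).mpr s.2,
        Submodule.starProjection_eq_self_iff.mpr x.2, add_zero]
    have := h _ hs _ ht (by rw [pr, pr])
    rw [Submodule.reflection_apply, pr] at this
    convert this using 1
    push_cast
    module
  -- Both measures are Haar measures, hence proportional; the value of the factor is irrelevant.
  rw [Measure.isAddLeftInvariant_eq_smul (volume : Measure V) ν, Measure.smul_apply,
    Measure.smul_apply]
  gcongr

end FiberVolume

/-! ### Support functions and the Hausdorff distance -/

namespace ConvexBody

variable {V : Type*} [NormedAddCommGroup V] [InnerProductSpace ℝ V]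

/-- The support function of a convex body. -/
noncomputable def supportFun (K : ConvexBody V) (u : V) : ℝ :=
  sSup ((fun x => inner ℝ x u) '' (K : Set V))

theorem isCompact_image_inner (K : ConvexBody V) (u : V) :
    IsCompact ((fun x => inner ℝ x u) '' (K : Set V)) :=
  K.isCompact.image (by fun_prop)

theorem inner_le_supportFun (K : ConvexBody V) {x : V} (hx : x ∈ (K : Set V)) (u : V) :
    inner ℝ x u ≤ K.supportFun u :=
  le_csSup (K.isCompact_image_inner u).bddAbove ⟨x, hx, rfl⟩

theorem supportFun_le (K : ConvexBody V) {u : V} {c : ℝ}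
    (h : ∀ x ∈ (K : Set V), inner ℝ x u ≤ c) : K.supportFun u ≤ c := by
  refine csSup_le (K.nonempty.image _) ?_
  rintro _ ⟨x, hx, rfl⟩
  exact h x hx

theorem exists_inner_eq_supportFun (K : ConvexBody V) (u : V) :
    ∃ x ∈ (K : Set V), inner ℝ x u = K.supportFun u :=
  (K.isCompact_image_inner u).sSup_mem (K.nonempty.image _)

theorem supportFun_mono {K L : ConvexBody V} (h : (K : Set V) ⊆ L) (u : V) :
    K.supportFun u ≤ L.supportFun u :=
  K.supportFun_le fun _ hx => L.inner_le_supportFun (h hx) u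

/-- Take `y` nearest to `x` and `u` the unit vector along `x - y`. The obtuse-angle criterion says
that `y` maximises the inner product with `u` on `L`, so the hypothesis at `u` bounds `‖x - y‖`. -/
theorem exists_dist_le_of_inner_le (L : ConvexBody V) {x : V} {δ : ℝ} (hδ : 0 ≤ δ)
    (h : ∀ u : V, ‖u‖ = 1 → inner ℝ x u ≤ L.supportFun u + δ) :
    ∃ y ∈ (L : Set V), dist x y ≤ δ := by
  obtain ⟨y, hy, hxy⟩ := exists_norm_eq_iInf_of_complete_convex L.nonempty
    L.isCompact.isComplete L.convex x
  rw [norm_eq_iInf_iff_real_inner_le_zero L.convex hy] at hxy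
  refine ⟨y, hy, ?_⟩
  rcases eq_or_ne x y with rfl | hne
  · simpa using hδ
  have hpos : 0 < ‖x - y‖ := norm_pos_iff.mpr (sub_ne_zero.mpr hne)
  set u : V := ‖x - y‖⁻¹ • (x - y) with hu
  have hu1 : ‖u‖ = 1 := by
    rw [hu, norm_smul, norm_inv, norm_norm, inv_mul_cancel₀ hpos.ne']
  have h1 : L.supportFun u ≤ inner ℝ y u := L.supportFun_le fun z hz => by
    have h2 := hxy z hz
    have h3 : inner ℝ (z - y) u ≤ 0 := by
      rw [hu, inner_smul_right, real_inner_comm]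
      exact mul_nonpos_of_nonneg_of_nonpos (inv_nonneg.mpr hpos.le) h2
    rw [inner_sub_left] at h3
    linarith
  have h4 : inner ℝ (x - y) u = ‖x - y‖ := by
    rw [hu, inner_smul_right, real_inner_self_eq_norm_sq]
    field_simp
  rw [inner_sub_left] at h4
  rw [dist_eq_norm]
  linarith [h u hu1]

theorem mem_of_inner_le (L : ConvexBody V) {x : V}
    (h : ∀ u : V, ‖u‖ = 1 → inner ℝ x u ≤ L.supportFun u) : x ∈ (L : Set V) := by
  obtain ⟨y, hy, hxy⟩ := L.exists_dist_le_of_inner_le le_rfl fun u hu => by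
    simpa using h u hu
  rwa [dist_le_zero.mp hxy]

theorem subset_of_supportFun_le {K L : ConvexBody V}
    (h : ∀ u : V, ‖u‖ = 1 → K.supportFun u ≤ L.supportFun u) : (K : Set V) ⊆ L :=
  fun _ hx => L.mem_of_inner_le fun u hu => (K.inner_le_supportFun hx u).trans (h u hu)

theorem dist_le_of_abs_supportFun_sub_le {K L : ConvexBody V} {δ : ℝ} (hδ : 0 ≤ δ)
    (h : ∀ u : V, ‖u‖ = 1 → |K.supportFun u - L.supportFun u| ≤ δ) : dist K L ≤ δ := by
  refine Metric.hausdorffDist_le_of_mem_dist hδ ?_ ?_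
  · refine fun x hx => L.exists_dist_le_of_inner_le hδ fun u hu => ?_
    linarith [K.inner_le_supportFun hx u, (abs_le.mp (h u hu)).2]
  · refine fun x hx => K.exists_dist_le_of_inner_le hδ fun u hu => ?_
    linarith [L.inner_le_supportFun hx u, (abs_le.mp (h u hu)).1]

theorem exists_mem_dist_le (K L : ConvexBody V) {x : V} (hx : x ∈ (K : Set V)) :
    ∃ y ∈ (L : Set V), dist x y ≤ dist K L := by
  obtain ⟨y, hy, hxy⟩ := L.isCompact.exists_infDist_eq_dist L.nonempty x
  exact ⟨y, hy, hxy ▸ Metric.infDist_le_hausdorffDist_of_mem hx hausdorffEDist_ne_top⟩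

theorem supportFun_sub_le (K L : ConvexBody V) (u : V) :
    K.supportFun u - L.supportFun u ≤ dist K L * ‖u‖ := by
  obtain ⟨x, hx, hxu⟩ := K.exists_inner_eq_supportFun u
  obtain ⟨y, hy, hxy⟩ := K.exists_mem_dist_le L hx
  have h1 := L.inner_le_supportFun hy u
  have h2 : inner ℝ (x - y) u ≤ dist x y * ‖u‖ := by
    rw [dist_eq_norm]; exact real_inner_le_norm _ _
  rw [inner_sub_left] at h2
  have := mul_le_mul_of_nonneg_right hxy (norm_nonneg u)
  linarith

theorem abs_supportFun_sub_le (K L : ConvexBody V) (u : V) :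
    |K.supportFun u - L.supportFun u| ≤ dist K L * ‖u‖ := by
  refine abs_sub_le_iff.mpr ⟨K.supportFun_sub_le L u, ?_⟩
  rw [dist_comm]
  exact L.supportFun_sub_le K u

theorem supportFun_sub_le_of_norm_le (K : ConvexBody V) {R : ℝ}
    (hR : ∀ x ∈ (K : Set V), ‖x‖ ≤ R) (u v : V) :
    K.supportFun u - K.supportFun v ≤ R * ‖u - v‖ := by
  obtain ⟨x, hx, hxu⟩ := K.exists_inner_eq_supportFun u
  have h1 := K.inner_le_supportFun hx v
  have h2 := (real_inner_le_norm x (u - v)).trans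
    (mul_le_mul_of_nonneg_right (hR x hx) (norm_nonneg _))
  rw [inner_sub_right] at h2
  linarith

theorem exists_norm_le (K : ConvexBody V) : ∃ R : ℝ, 0 < R ∧ ∀ x ∈ (K : Set V), ‖x‖ ≤ R :=
  K.isBounded.exists_pos_norm_le

theorem continuous_supportFun (K : ConvexBody V) : Continuous K.supportFun := by
  obtain ⟨R, hR0, hR⟩ := K.exists_norm_le
  refine (LipschitzWith.of_le_add_mul R.toNNReal fun u v => ?_).continuous
  rw [Real.coe_toNNReal _ hR0.le, dist_eq_norm]
  linarith [K.supportFun_sub_le_of_norm_le hR u v]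

theorem supportFun_le_of_norm_le (K : ConvexBody V) {R : ℝ}
    (hR : ∀ x ∈ (K : Set V), ‖x‖ ≤ R) {u : V} (hu : ‖u‖ = 1) : K.supportFun u ≤ R :=
  K.supportFun_le fun x hx => (real_inner_le_norm x u).trans (by rw [hu, mul_one]; exact hR x hx)

theorem neg_le_supportFun_of_norm_le (K : ConvexBody V) {R : ℝ}
    (hR : ∀ x ∈ (K : Set V), ‖x‖ ≤ R) {u : V} (hu : ‖u‖ = 1) : -R ≤ K.supportFun u := by
  obtain ⟨x, hx⟩ := K.nonempty
  have h1 := K.inner_le_supportFun hx u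
  have h2 := neg_le_of_abs_le (abs_real_inner_le_norm x u)
  rw [hu, mul_one] at h2
  linarith [hR x hx]

theorem supportFun_add (K L : ConvexBody V) (u : V) :
    (K + L).supportFun u = K.supportFun u + L.supportFun u := by
  refine le_antisymm ((K + L).supportFun_le ?_) ?_
  · rintro _ ⟨x, hx, y, hy, rfl⟩
    simp only [inner_add_left]
    exact add_le_add (K.inner_le_supportFun hx u) (L.inner_le_supportFun hy u)
  · obtain ⟨x, hx, hxu⟩ := K.exists_inner_eq_supportFun u
    obtain ⟨y, hy, hyu⟩ := L.exists_inner_eq_supportFun u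
    rw [← hxu, ← hyu, ← inner_add_left]
    exact (K + L).inner_le_supportFun (Set.add_mem_add hx hy) u

theorem supportFun_smul (K : ConvexBody V) {c : ℝ} (hc : 0 ≤ c) (u : V) :
    (c • K).supportFun u = c * K.supportFun u := by
  refine le_antisymm ((c • K).supportFun_le ?_) ?_
  · rintro _ ⟨x, hx, rfl⟩
    simp only [real_inner_smul_left]
    exact mul_le_mul_of_nonneg_left (K.inner_le_supportFun hx u) hc
  · obtain ⟨x, hx, hxu⟩ := K.exists_inner_eq_supportFun u
    rw [← hxu, ← real_inner_smul_left]
    exact (c • K).inner_le_supportFun (Set.smul_mem_smul_set hx) u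

/-- The closed unit ball. -/
def unitBall (V : Type*) [NormedAddCommGroup V] [NormedSpace ℝ V] [ProperSpace V] :
    ConvexBody V where
  carrier := Metric.closedBall 0 1
  convex' := convex_closedBall _ _
  isCompact' := isCompact_closedBall _ _
  nonempty' := ⟨0, by simp⟩

theorem mem_unitBall [ProperSpace V] {x : V} : x ∈ (unitBall V : Set V) ↔ ‖x‖ ≤ 1 :=
  mem_closedBall_zero_iff

theorem supportFun_unitBall [ProperSpace V] {u : V} (hu : ‖u‖ = 1) :
    (unitBall V).supportFun u = 1 := by
  refine le_antisymm ((unitBall V).supportFun_le_of_norm_le (fun x hx => mem_unitBall.mp hx) hu) ?_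
  have := (unitBall V).inner_le_supportFun (mem_unitBall.mpr hu.le) u
  rwa [real_inner_self_eq_norm_sq, hu, one_pow] at this

/-- The space of convex bodies is complete. -/
theorem exists_tendsto_of_cauchySeq [CompleteSpace V] {K : ℕ → ConvexBody V} (hK : CauchySeq K) :
    ∃ L : ConvexBody V, Tendsto K atTop (𝓝 L) := by
  let ι : ConvexBody V → TopologicalSpace.NonemptyCompacts V := fun K =>
    ⟨⟨K, K.isCompact⟩, K.nonempty⟩
  have hι : Isometry ι := Isometry.of_dist_eq fun K L => rfl
  obtain ⟨L, hL⟩ := cauchySeq_tendsto_of_complete (hι.uniformContinuous.comp_cauchySeq hK)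
  -- Nonempty compacts are complete; only convexity of the limit is at stake. Endpoints in `L` are
  -- moved to `K N`, combined there, and the result is moved back to `L`.
  have hconv : Convex ℝ (L : Set V) := by
    intro x hx y hy a b ha hb hab
    rw [← L.isCompact.isClosed.closure_eq, Metric.mem_closure_iff]
    intro ε hε
    obtain ⟨N, hN⟩ := (Metric.tendsto_atTop.mp hL (ε / 3) (by positivity))
    have hd : Metric.hausdorffDist (K N : Set V) (L : Set V) < ε / 3 := hN N le_rfl
    have hfin : Metric.hausdorffEDist (K N : Set V) (L : Set V) ≠ ⊤ :=
      Metric.hausdorffEDist_ne_top_of_nonempty_of_bounded (K N).nonempty L.nonempty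
        (K N).isBounded L.isCompact.isBounded
    obtain ⟨x', hx', hxx⟩ := Metric.exists_dist_lt_of_hausdorffDist_lt' hx hd hfin
    obtain ⟨y', hy', hyy⟩ := Metric.exists_dist_lt_of_hausdorffDist_lt' hy hd hfin
    obtain ⟨z, hz, hzz⟩ := Metric.exists_dist_lt_of_hausdorffDist_lt
      ((K N).convex hx' hy' ha hb hab) hd hfin
    refine ⟨z, hz, ?_⟩
    have : dist (a • x + b • y) (a • x' + b • y') ≤ ε / 3 := by
      rw [dist_comm] at hxx hyy
      calc dist (a • x + b • y) (a • x' + b • y') ≤ dist (a • x) (a • x') + dist (b • y) (b • y') :=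
            dist_add_add_le _ _ _ _
        _ = a * dist x x' + b * dist y y' := by
            rw [dist_smul₀, dist_smul₀, Real.norm_of_nonneg ha, Real.norm_of_nonneg hb]
        _ ≤ a * (ε / 3) + b * (ε / 3) := by
            gcongr
        _ = ε / 3 := by rw [← add_mul, hab, one_mul]
    linarith [dist_triangle (a • x + b • y) (a • x' + b • y') z]
  let L' : ConvexBody V := ⟨L, hconv, L.isCompact, L.nonempty⟩
  refine ⟨L', ?_⟩
  rw [hι.isUniformInducing.isInducing.tendsto_nhds_iff]
  exact hL

end ConvexBody

/-! ### Integration over the unit sphere and polar coordinates -/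

section SphereIntegration

open Metric Module

variable {V : Type*} [NormedAddCommGroup V] [InnerProductSpace ℝ V]
  [FiniteDimensional ℝ V] [MeasurableSpace V] [BorelSpace V]

/-- The surface measure on the unit sphere. -/
noncomputable abbrev surfaceMeasure (V : Type*) [NormedAddCommGroup V] [InnerProductSpace ℝ V]
    [FiniteDimensional ℝ V] [MeasurableSpace V] [BorelSpace V] : Measure (sphere (0 : V) 1) :=
  (volume : Measure V).toSphere

/-- A linear isometry as a map of the unit sphere. -/
def sphereMap (e : V ≃ₗᵢ[ℝ] V) (u : sphere (0 : V) 1) : sphere (0 : V) 1 :=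
  ⟨e u, by simp⟩

/-- The surface measure is a multiple of the volume of the cone over a set, and linear isometries
carry cones to cones. -/
theorem measurePreserving_sphereMap (e : V ≃ₗᵢ[ℝ] V) :
    MeasurePreserving (sphereMap e) (surfaceMeasure V) (surfaceMeasure V) := by
  have hm : Measurable (sphereMap e) :=
    (Continuous.subtype_mk (e.continuous.comp continuous_subtype_val) _).measurable
  refine ⟨hm, Measure.ext fun s hs => ?_⟩
  rw [Measure.map_apply hm hs, Measure.toSphere_apply' _ (hm hs), Measure.toSphere_apply' _ hs]
  congr 1
  have : Ioo (0 : ℝ) 1 • ((↑) '' (sphereMap e ⁻¹' s) : Set V) =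
      e ⁻¹' (Ioo (0 : ℝ) 1 • ((↑) '' s : Set V)) := by
    ext x
    simp only [Set.mem_smul, mem_preimage, mem_image]
    constructor
    · rintro ⟨r, hr, _, ⟨u, hu, rfl⟩, rfl⟩
      exact ⟨r, hr, _, ⟨_, hu, rfl⟩, by simp [sphereMap]⟩
    · rintro ⟨r, hr, _, ⟨u, hu, rfl⟩, hx⟩
      refine ⟨r, hr, _, ⟨⟨e.symm u, by simp⟩, ?_, rfl⟩, ?_⟩
      · simpa [sphereMap] using hu
      · apply e.injective
        simp [← hx]
  rw [this]
  exact e.measurePreserving.measure_preimage_equiv (f := e.toMeasurableEquiv) _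

theorem integral_comp_sphere (e : V ≃ₗᵢ[ℝ] V) (f : V → ℝ) :
    ∫ u, f (e u) ∂surfaceMeasure V = ∫ u, f u ∂surfaceMeasure V := by
  have hemb : MeasurableEmbedding (sphereMap e) := by
    refine Topology.IsClosedEmbedding.measurableEmbedding ?_
    refine Continuous.isClosedEmbedding
      (Continuous.subtype_mk (e.continuous.comp continuous_subtype_val) _) fun u v h => ?_
    exact Subtype.ext (e.injective (congrArg Subtype.val h))
  exact (measurePreserving_sphereMap e).integral_comp hemb fun u => f u

theorem integrable_sphere {f : V → ℝ} (hf : Continuous f) :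
    Integrable (fun u : sphere (0 : V) 1 => f u) (surfaceMeasure V) :=
  (hf.comp continuous_subtype_val).integrable_of_hasCompactSupport
    (HasCompactSupport.of_compactSpace _)

theorem MeasureTheory.Measure.volumeIoiPow_apply_Iic (n : ℕ) (x : Ioi (0 : ℝ)) :
    Measure.volumeIoiPow n (Iic x) = ENNReal.ofReal (x.1 ^ (n + 1) / (n + 1)) := by
  rw [← volumeIoiPow_apply_Iio]
  have h0 : Measure.volumeIoiPow n {x} = 0 := by
    refine withDensity_absolutelyContinuous _ _ ?_
    rw [(MeasurableEmbedding.subtype_coe measurableSet_Ioi).comap_apply]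
    simp
  refine le_antisymm ?_ (measure_mono Iio_subset_Iic_self)
  rw [← Iio_union_right]
  exact (measure_union_le _ _).trans (by simp [h0])

/-- Volume of a starshaped set in polar coordinates. -/
theorem volume_setOf_norm_le_radial [Nontrivial V] {ρ : V → ℝ} (hρ : Continuous ρ)
    (hpos : ∀ u : V, ‖u‖ = 1 → 0 < ρ u) :
    volume.real {x : V | x ≠ 0 ∧ ‖x‖ ≤ ρ (‖x‖⁻¹ • x)} =
      (∫ u, ρ u ^ finrank ℝ V ∂surfaceMeasure V) / finrank ℝ V := by
  have hd : 0 < finrank ℝ V := finrank_pos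
  let A : Set (sphere (0 : V) 1 × Ioi (0 : ℝ)) := {p | (p.2 : ℝ) ≤ ρ p.1}
  have hA : MeasurableSet A :=
    (isClosed_le (continuous_subtype_val.comp continuous_snd)
      (hρ.comp (continuous_subtype_val.comp continuous_fst))).measurableSet
  have hset : {x : V | x ≠ 0 ∧ ‖x‖ ≤ ρ (‖x‖⁻¹ • x)} =
      (↑) '' (homeomorphUnitSphereProd V ⁻¹' A) := by
    ext x
    simp only [mem_ofPred_eq, mem_image, mem_preimage, A]
    constructor
    · rintro ⟨hx, h⟩
      exact ⟨⟨x, hx⟩, by simpa using h, rfl⟩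
    · rintro ⟨⟨y, hy⟩, h, rfl⟩
      exact ⟨hy, by simpa using h⟩
  have hvol : volume {x : V | x ≠ 0 ∧ ‖x‖ ≤ ρ (‖x‖⁻¹ • x)} =
      ∫⁻ u, ENNReal.ofReal (ρ u ^ finrank ℝ V / finrank ℝ V) ∂surfaceMeasure V := by
    rw [hset, ← comap_subtype_coe_apply (measurableSet_singleton (0 : V)).compl,
      (volume : Measure V).measurePreserving_homeomorphUnitSphereProd.measure_preimage
        hA.nullMeasurableSet, Measure.prod_apply hA]
    refine lintegral_congr fun u => ?_
    have : Prod.mk u ⁻¹' A = Iic ⟨ρ u, hpos u (norm_eq_of_mem_sphere u)⟩ := by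
      ext r; rfl
    rw [this, Measure.volumeIoiPow_apply_Iic, Nat.sub_add_cancel hd, Nat.cast_pred hd,
      sub_add_cancel]
  rw [measureReal_def, hvol, ← integral_div, integral_eq_lintegral_of_nonneg_ae]
  · exact ae_of_all _ fun u => div_nonneg (pow_nonneg (hpos u (norm_eq_of_mem_sphere u)).le _)
      (Nat.cast_nonneg _)
  · exact (integrable_sphere ((hρ.pow _).div_const _)).aestronglyMeasurable

/-- A nonzero `x ∈ K` has norm `⟨x, x / ‖x‖⟩`, at most the support function in its own direction, so
off the origin `K` lies in the starshaped set whose radial function is its support function. -/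
theorem volume_real_le_integral_supportFun_pow [Nontrivial V] (K : ConvexBody V)
    (hpos : ∀ u : V, ‖u‖ = 1 → 0 < K.supportFun u) :
    volume.real (K : Set V) ≤
      (∫ u, K.supportFun u ^ finrank ℝ V ∂surfaceMeasure V) / finrank ℝ V := by
  rw [← volume_setOf_norm_le_radial K.continuous_supportFun hpos]
  have hsub : (K : Set V) \ {0} ⊆ {x : V | x ≠ 0 ∧ ‖x‖ ≤ K.supportFun (‖x‖⁻¹ • x)} := by
    rintro x ⟨hx, hx0⟩
    refine ⟨hx0, ?_⟩
    have h := K.inner_le_supportFun hx (‖x‖⁻¹ • x)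
    rw [inner_smul_right, real_inner_self_eq_norm_sq] at h
    have : ‖x‖ ≠ 0 := norm_ne_zero_iff.mpr hx0
    rwa [sq, ← mul_assoc, inv_mul_cancel₀ this, one_mul] at h
  rw [← measureReal_sdiff_null (μ := volume) (s₂ := ({0} : Set V)) (by simp [measureReal_def])
    (by simp)]
  refine measureReal_mono hsub ?_
  obtain ⟨C, hC⟩ := (isCompact_sphere (0 : V) 1).bddAbove_image
    K.continuous_supportFun.continuousOn
  refine ne_top_of_le_ne_top (measure_closedBall_lt_top (x := (0 : V)) (r := C)).ne
    (measure_mono ?_)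
  rintro x ⟨hx0, hx⟩
  rw [mem_closedBall_zero_iff]
  refine hx.trans (hC ⟨_, ?_, rfl⟩)
  simp [norm_smul, hx0]

theorem integral_pow_le_volume_real [Nontrivial V] (K : ConvexBody V) {ρ : V → ℝ}
    (hρ : Continuous ρ) (hpos : ∀ u : V, ‖u‖ = 1 → 0 < ρ u) (h0 : (0 : V) ∈ (K : Set V))
    (h : ∀ u : V, ‖u‖ = 1 → ρ u • u ∈ (K : Set V)) :
    (∫ u, ρ u ^ finrank ℝ V ∂surfaceMeasure V) / finrank ℝ V ≤ volume.real (K : Set V) := by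
  rw [← volume_setOf_norm_le_radial hρ hpos]
  refine measureReal_mono ?_ K.isCompact.measure_lt_top.ne
  rintro x ⟨hx0, hx⟩
  have hn : ‖‖x‖⁻¹ • x‖ = 1 := by simp [norm_smul, hx0]
  have hx' : ‖x‖ ≠ 0 := norm_ne_zero_iff.mpr hx0
  have := K.convex.smul_mem_of_zero_mem h0 (h _ hn) (t := ‖x‖ / ρ (‖x‖⁻¹ • x))
    ⟨div_nonneg (norm_nonneg _) (hpos _ hn).le, (div_le_one (hpos _ hn)).mpr hx⟩
  rwa [smul_smul, div_mul_cancel₀ _ (hpos _ hn).ne', smul_smul, mul_inv_cancel₀ hx', one_smul]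
    at this

/-- An `L¹`-small Lipschitz function on the sphere is uniformly small. -/
theorem exists_forall_abs_le_of_integral_lt {R η : ℝ} (hR : 0 < R) (hη : 0 < η) :
    ∃ δ > 0, ∀ f : V → ℝ, Continuous f → (∀ u v, |f u - f v| ≤ R * ‖u - v‖) →
      ∫ u, |f u| ∂surfaceMeasure V < δ → ∀ u : V, ‖u‖ = 1 → |f u| ≤ η := by
  -- If `|f u| > η`, the Lipschitz bound keeps `|f| ≥ η / 2` on the cap of radius `r` about `u`,
  -- whose measure is at least a positive `m` independent of `u`.
  set r := η / (2 * R) with hr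
  have hr0 : 0 < r := by positivity
  set m : ℝ := Measure.toSphereBallBound (finrank ℝ V) r * (volume : Measure V).real (ball 0 1)
  have hm : 0 < m := by
    refine mul_pos (Measure.toSphereBallBound_pos _ _) ?_
    exact ENNReal.toReal_pos (measure_ball_pos _ _ one_pos).ne' measure_ball_lt_top.ne
  refine ⟨η / 2 * m, by positivity, fun f hf hfR hδ u hu => ?_⟩
  by_contra! hlt
  have hcap := Measure.toSphereBallBound_mul_measureReal_unitBall_le_toSphere_ball
    (volume : Measure V) hr0 ⟨u, by simpa using hu⟩
  set B : Set (sphere (0 : V) 1) := ball ⟨u, by simpa using hu⟩ r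
  refine absurd hδ (not_lt.mpr ?_)
  have hint := integrable_sphere hf.abs
  calc η / 2 * m ≤ η / 2 * (surfaceMeasure V).real B := by gcongr
    _ = ∫ _ in B, η / 2 ∂surfaceMeasure V := by simp [mul_comm]
    _ ≤ ∫ v in B, |f v| ∂surfaceMeasure V := by
        refine setIntegral_mono_on (by simp) hint.integrableOn measurableSet_ball fun v hv => ?_
        have h1 := hfR u v
        have h2 : ‖u - (v : V)‖ < r := by
          rw [← dist_eq_norm, dist_comm]; exact hv
        have h3 : R * ‖u - (v : V)‖ ≤ η / 2 := by
          calc R * ‖u - (v : V)‖ ≤ R * r := by gcongr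
            _ = η / 2 := by rw [hr]; field_simp
        have h4 := abs_sub_abs_le_abs_sub (f u) (f v)
        linarith
    _ ≤ ∫ v, |f v| ∂surfaceMeasure V :=
        setIntegral_le_integral hint (ae_of_all _ fun _ => abs_nonneg _)

end SphereIntegration

/-! ### Minkowski symmetrals and the sandwich property -/

namespace SymmProc

variable {n : ℕ}

theorem half_add_reflection_mem_minkowski (H : Submodule ℝ (E n)) {K : KK n} {p q : E n}
    (hp : p ∈ (K : Set (E n))) (hq : q ∈ (K : Set (E n))) :
    (1 / 2 : ℝ) • (p + H.reflection q) ∈ (minkowski H K : Set (E n)) :=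
  Set.smul_mem_smul_set (Set.add_mem_add hp (mem_image_of_mem _ hq))

theorem exists_of_mem_minkowski {H : Submodule ℝ (E n)} {K : KK n} {x : E n}
    (hx : x ∈ (minkowski H K : Set (E n))) :
    ∃ p ∈ (K : Set (E n)), ∃ q ∈ (K : Set (E n)), (1 / 2 : ℝ) • (p + H.reflection q) = x := by
  obtain ⟨_, ⟨p, hp, _, ⟨q, hq, rfl⟩, rfl⟩, rfl⟩ := hx
  exact ⟨p, hp, q, hq, rfl⟩

theorem inner_reflection_left (H : Submodule ℝ (E n)) (x y : E n) :
    inner ℝ (H.reflection x) y = inner ℝ x (H.reflection y) := by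
  rw [← H.reflection.inner_map_map, Submodule.reflection_reflection]

theorem supportFun_minkowski (H : Submodule ℝ (E n)) (K : KK n) (u : E n) :
    (minkowski H K).supportFun u = (K.supportFun u + K.supportFun (H.reflection u)) / 2 := by
  have key : ∀ p q : E n, inner ℝ ((1 / 2 : ℝ) • (p + H.reflection q)) u =
      (inner ℝ p u + inner ℝ q (H.reflection u)) / 2 := fun p q => by
    rw [real_inner_smul_left, inner_add_left, inner_reflection_left]; ring
  refine le_antisymm ((minkowski H K).supportFun_le fun x hx => ?_) ?_
  · obtain ⟨p, hp, q, hq, rfl⟩ := exists_of_mem_minkowski hx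
    rw [key]
    linarith [K.inner_le_supportFun hp u, K.inner_le_supportFun hq (H.reflection u)]
  · obtain ⟨p, hp, hpu⟩ := K.exists_inner_eq_supportFun u
    obtain ⟨q, hq, hqu⟩ := K.exists_inner_eq_supportFun (H.reflection u)
    rw [← hpu, ← hqu, ← key]
    exact (minkowski H K).inner_le_supportFun (half_add_reflection_mem_minkowski H hp hq) u

theorem minkowski_mono (H : Submodule ℝ (E n)) {K L : KK n} (h : (K : Set (E n)) ⊆ L) :
    (minkowski H K : Set (E n)) ⊆ minkowski H L := by
  intro x hx
  obtain ⟨p, hp, q, hq, rfl⟩ := exists_of_mem_minkowski hx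
  exact half_add_reflection_mem_minkowski H (h hp) (h hq)

theorem norm_le_of_mem_minkowski {H : Submodule ℝ (E n)} {K : KK n} {R : ℝ}
    (hR : ∀ x ∈ (K : Set (E n)), ‖x‖ ≤ R) : ∀ x ∈ (minkowski H K : Set (E n)), ‖x‖ ≤ R := by
  intro x hx
  obtain ⟨p, hp, q, hq, rfl⟩ := exists_of_mem_minkowski hx
  have h1 := norm_add_le p (H.reflection q)
  rw [LinearIsometryEquiv.norm_map] at h1
  rw [norm_smul, Real.norm_of_nonneg (by norm_num)]
  linarith [hR p hp, hR q hq]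

/-- A map between the fiber symmetrization and the Minkowski symmetrization with respect to `H`. -/
structure IsSandwiched (H : Submodule ℝ (E n)) (T : KK n → KK n) : Prop where
  fiber_mem : ∀ K : KK n, ∀ p ∈ (K : Set (E n)), ∀ q ∈ (K : Set (E n)),
    H.starProjection p = H.starProjection q →
      (1 / 2 : ℝ) • (p + H.reflection q) ∈ (T K : Set (E n))
  subset_minkowski : ∀ K : KK n, (T K : Set (E n)) ⊆ minkowski H K

/-- A segment as a convex body. -/
def segmentBody (x y : E n) : KK n where
  carrier := segment ℝ x y
  convex' := convex_segment x y
  isCompact' := by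
    rw [segment_eq_image_lineMap]
    exact isCompact_Icc.image AffineMap.lineMap_continuous
  nonempty' := ⟨x, left_mem_segment ℝ x y⟩

theorem isHSymmetric_segmentBody (H : Submodule ℝ (E n)) (z : E n) :
    IsHSymmetric H (segmentBody z (H.reflection z) : Set (E n)) := by
  change H.reflection '' segment ℝ z (H.reflection z) = segment ℝ z (H.reflection z)
  have := image_segment ℝ H.reflection.toLinearEquiv.toLinearMap.toAffineMap z (H.reflection z)
  refine this.trans ?_
  change segment ℝ (H.reflection z) (H.reflection (H.reflection z)) = _
  rw [Submodule.reflection_reflection, segment_symm]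

theorem reflection_eq_neg_of_mem_orthogonal {H : Submodule ℝ (E n)} {t : E n} (ht : t ∈ Hᗮ) :
    H.reflection t = -t := by
  rw [Submodule.reflection_apply, (Submodule.starProjection_apply_eq_zero_iff H).mpr ht]
  simp

/-- Both inclusions compare `K` with a translate, along `Hᗮ`, of an `H`-symmetric body: a segment
inside `K` for the lower one, an intersection of two mirror half-spaces with a ball around `K` for
the upper one. Monotonicity and translation invariance then transfer the inclusion to `◇_H K`. -/
theorem isSandwiched_of_mem_familyF {D : Symmetrization n} (hD : D ∈ familyF n)
    (H : Submodule ℝ (E n)) : IsSandwiched H (D.toFun H) := by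
  obtain ⟨hmono, htrans, -⟩ := hD
  refine ⟨fun K p hp q hq hpq => ?_, fun K => ?_⟩
  · set z := (1 / 2 : ℝ) • (p + H.reflection q) with hz
    -- Translation by `t` carries the symmetric segment from `z` to `R_H z` onto the segment from
    -- `p` to `q`.
    set t := (1 / 2 : ℝ) • (p + q) - H.starProjection p with ht
    have htH : t ∈ Hᗮ := by
      have : t = (1 / 2 : ℝ) • ((p - H.starProjection p) + (q - H.starProjection q)) := by
        rw [ht, hpq]; module
      rw [this]
      exact Hᗮ.smul_mem _ (Hᗮ.add_mem (Submodule.sub_starProjection_mem_orthogonal p)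
        (Submodule.sub_starProjection_mem_orthogonal q))
    have e1 : z + t = p := by
      rw [hz, ht, Submodule.reflection_apply, hpq]; module
    have e2 : H.reflection z + t = q := by
      rw [hz, ht, map_smul, map_add, Submodule.reflection_reflection, Submodule.reflection_apply]
      module
    have hsub : (translate (segmentBody z (H.reflection z)) t : Set (E n)) ⊆ K := by
      rintro _ ⟨s, ⟨a, b, ha, hb, hab, rfl⟩, rfl⟩
      have := K.convex hp hq ha hb hab
      rw [← e1, ← e2] at this
      convert this using 1
      simp only
      have e : t = a • t + b • t := by rw [← add_smul, hab, one_smul]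
      nth_rewrite 1 [e]
      module
    have := hmono H _ _ hsub
    rw [htrans H _ (isHSymmetric_segmentBody H z) t htH] at this
    exact this (left_mem_segment ℝ _ _)
  · refine ConvexBody.subset_of_supportFun_le fun u _ => ?_
    rw [supportFun_minkowski]
    set a := K.supportFun u with ha
    set b := K.supportFun (H.reflection u) with hb
    -- Shifting by `-t` balances the support values at `u` and `R_H u`: both become `(a + b) / 2`,
    -- the support value of `M_H K` at `u`. If `u ∈ H` they already agree.
    obtain ⟨t, htH, htu⟩ : ∃ t ∈ Hᗮ, inner ℝ t u = (a - b) / 2 := by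
      set w := u - H.starProjection u with hw
      have hwH : w ∈ Hᗮ := Submodule.sub_starProjection_mem_orthogonal u
      rcases eq_or_ne w 0 with h0 | h0
      · have hu : H.reflection u = u := by
          rw [Submodule.reflection_apply, ← sub_eq_zero.mp h0]; module
        exact ⟨0, zero_mem _, by rw [ha, hb, hu]; simp⟩
      · have hwu : inner ℝ w u = ‖w‖ ^ 2 := by
          have h1 : inner ℝ w (H.starProjection u) = 0 :=
            Submodule.inner_left_of_mem_orthogonal (Submodule.starProjection_apply_mem H u) hwH
          have h2 : u = w + H.starProjection u := by rw [hw]; abel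
          nth_rewrite 1 [h2]
          rw [inner_add_right, h1, add_zero, real_inner_self_eq_norm_sq]
        refine ⟨((a - b) / 2 / ‖w‖ ^ 2) • w, Hᗮ.smul_mem _ hwH, ?_⟩
        have : ‖w‖ ≠ 0 := norm_ne_zero_iff.mpr h0
        rw [real_inner_smul_left, hwu]
        field_simp
    obtain ⟨ρ, hρ, hK⟩ := K.exists_norm_le
    -- The norm bound serves only to make `S` compact.
    let S : Set (E n) := {x | inner ℝ x u ≤ (a + b) / 2 ∧
      inner ℝ x (H.reflection u) ≤ (a + b) / 2 ∧ ‖x‖ ≤ ρ + ‖t‖}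
    have hKS : ∀ y ∈ (K : Set (E n)), y - t ∈ S := by
      intro y hy
      have h1 := K.inner_le_supportFun hy u
      have h2 := K.inner_le_supportFun hy (H.reflection u)
      refine ⟨?_, ?_, ?_⟩
      · rw [inner_sub_left, htu]; linarith
      · rw [inner_sub_left, ← inner_reflection_left H t, reflection_eq_neg_of_mem_orthogonal htH,
          inner_neg_left, htu]
        linarith
      · exact (norm_sub_le _ _).trans (by gcongr; exact hK y hy)
    have hSc : Convex ℝ S := by
      have h1 : ∀ v : E n, Convex ℝ {x : E n | inner ℝ x v ≤ (a + b) / 2} := fun v => by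
        refine convex_halfSpace_le ⟨fun x y => inner_add_left x y v, fun c x => ?_⟩ _
        exact real_inner_smul_left x v c
      have h2 : Convex ℝ {x : E n | ‖x‖ ≤ ρ + ‖t‖} := by
        simpa using (convexOn_univ_norm (E := E n)).convex_le (ρ + ‖t‖)
      exact (h1 u).inter ((h1 _).inter h2)
    have hcl : ∀ v : E n, IsClosed {x : E n | inner ℝ x v ≤ (a + b) / 2} := fun v =>
      isClosed_le (by fun_prop) continuous_const
    have hScl : IsClosed S := (hcl u).inter ((hcl _).inter
      (isClosed_le continuous_norm continuous_const))
    have hScpt : IsCompact S :=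
      (isCompact_closedBall (0 : E n) (ρ + ‖t‖)).of_isClosed_subset hScl
        fun x hx => mem_closedBall_zero_iff.mpr hx.2.2
    let SB : KK n := ⟨S, hSc, hScpt, K.nonempty.elim fun y hy => ⟨y - t, hKS y hy⟩⟩
    have hSsym : IsHSymmetric H (SB : Set (E n)) := by
      have hmaps : ∀ x ∈ S, H.reflection x ∈ S := by
        rintro x ⟨h1, h2, h3⟩
        refine ⟨?_, ?_, ?_⟩
        · rwa [inner_reflection_left]
        · rwa [H.reflection.inner_map_map]
        · rwa [LinearIsometryEquiv.norm_map]
      refine Subset.antisymm (image_subset_iff.mpr hmaps) fun x hx => ?_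
      exact ⟨H.reflection x, hmaps x hx, Submodule.reflection_reflection H x⟩
    have hsub : (K : Set (E n)) ⊆ translate SB t := fun y hy =>
      ⟨y - t, hKS y hy, sub_add_cancel y t⟩
    have := hmono H _ _ hsub
    rw [htrans H SB hSsym t htH] at this
    exact (D.toFun H K).supportFun_le fun x hx => (this hx).1

theorem isSandwiched_steiner (H : Submodule ℝ (E n)) (hH : Module.finrank ℝ H + 1 = n) :
    IsSandwiched H (steiner H hH) := by
  have e : ∀ K : KK n, (steiner H hH K : Set (E n)) = _ := fun K => steinerSet_eq H hH K
  refine ⟨fun K p hp q hq hpq => ?_, fun K => ?_⟩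
  · rw [e K]
    exact ⟨(p, q), ⟨⟨hp, hq⟩, hpq⟩, rfl⟩
  · rw [e K]
    rintro _ ⟨⟨p, q⟩, ⟨⟨hp, hq⟩, -⟩, rfl⟩
    exact half_add_reflection_mem_minkowski H hp hq

theorem IsSandwiched.volume_le {H : Submodule ℝ (E n)} {T : KK n → KK n} (hT : IsSandwiched H T)
    (K : KK n) : volume.real (K : Set (E n)) ≤ volume.real (T K : Set (E n)) :=
  ENNReal.toReal_mono (T K).isCompact.measure_lt_top.ne
    (volume_le_of_fiberwise_half_sub_mem K.isClosed.measurableSet (T K).isClosed.measurableSet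
      (hT.fiber_mem K))

/-- Apply the fibre condition to `x` and its mirror image, whose symmetrized midpoint is `x` itself.
-/
theorem IsSandwiched.ball_subset {H : Submodule ℝ (E n)} {T : KK n → KK n}
    (hT : IsSandwiched H T) {K : KK n} {r : ℝ} (hK : ∀ x : E n, ‖x‖ ≤ r → x ∈ (K : Set (E n)))
    (x : E n) (hx : ‖x‖ ≤ r) : x ∈ (T K : Set (E n)) := by
  have hp : H.starProjection (H.reflection x) = H.starProjection x := by
    rw [Submodule.reflection_apply, map_sub, map_nsmul,
      Submodule.starProjection_eq_self_iff.mpr (Submodule.starProjection_apply_mem H x)]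
    module
  have := hT.fiber_mem K x (hK x hx) (H.reflection x) (hK _ (by simpa using hx)) hp.symm
  rw [Submodule.reflection_reflection] at this
  convert this using 1
  module

/-! ### Iterated symmetrization, total width and `L¹` distance -/

/-- Index `j` already means `j + 1` applied maps, the last being `T (k + j)`; hence the restart at
`k + (j + 1)`. -/
theorem process_add (T : ℕ → KK n → KK n) (k : ℕ) (K : KK n) (j i : ℕ) :
    process T k K (j + 1 + i) = process T (k + (j + 1)) (process T k K j) i := by
  induction i with
  | zero => rfl
  | succ i ih =>
    change T (k + (j + 1 + i + 1)) (process T k K (j + 1 + i)) = T (k + (j + 1) + (i + 1)) _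
    rw [ih]
    congr 1
    omega

variable {T : ℕ → KK n → KK n} {H : ℕ → Submodule ℝ (E n)}

theorem process_subset_minkowski (hT : ∀ m, IsSandwiched (H m) (T m)) (k : ℕ) (K : KK n) (j : ℕ) :
    (process T k K j : Set (E n)) ⊆ process (fun m => minkowski (H m)) k K j := by
  induction j with
  | zero => exact (hT k).subset_minkowski K
  | succ j ih => exact ((hT _).subset_minkowski _).trans (minkowski_mono _ ih)

/-- A property preserved by every step is preserved by the process. -/
theorem process_induction {p : KK n → Prop} (hp : ∀ m K, p K → p (T m K)) (k : ℕ) {K : KK n}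
    (hK : p K) (j : ℕ) : p (process T k K j) := by
  induction j with
  | zero => exact hp _ _ hK
  | succ j ih => exact hp _ _ ih

/-- The integral of the support function over the unit sphere, a multiple of the mean width. -/
noncomputable def totalWidth (K : KK n) : ℝ := ∫ u, K.supportFun u ∂surfaceMeasure (E n)

/-- The `L¹` distance of the support functions on the unit sphere. -/
noncomputable def l1Dist (K L : KK n) : ℝ :=
  ∫ u, |K.supportFun u - L.supportFun u| ∂surfaceMeasure (E n)

theorem integrable_supportFun (K : KK n) :
    Integrable (fun u : Metric.sphere (0 : E n) 1 => K.supportFun u) (surfaceMeasure (E n)) :=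
  integrable_sphere K.continuous_supportFun

theorem integrable_abs_supportFun_sub (K L : KK n) :
    Integrable (fun u : Metric.sphere (0 : E n) 1 => |K.supportFun u - L.supportFun u|)
      (surfaceMeasure (E n)) :=
  ((integrable_supportFun K).sub (integrable_supportFun L)).abs

theorem l1Dist_comm (K L : KK n) : l1Dist K L = l1Dist L K := by
  simp only [l1Dist, abs_sub_comm]

theorem l1Dist_triangle (K L M : KK n) : l1Dist K M ≤ l1Dist K L + l1Dist L M := by
  rw [l1Dist, l1Dist, l1Dist, ← integral_add (integrable_abs_supportFun_sub K L)
    (integrable_abs_supportFun_sub L M)]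
  exact integral_mono (integrable_abs_supportFun_sub K M)
    ((integrable_abs_supportFun_sub K L).add (integrable_abs_supportFun_sub L M))
    fun u => abs_sub_le _ _ _

theorem l1Dist_eq_of_subset {K L : KK n} (h : (K : Set (E n)) ⊆ L) :
    l1Dist K L = totalWidth L - totalWidth K := by
  rw [totalWidth, totalWidth, ← integral_sub (integrable_supportFun L) (integrable_supportFun K),
    l1Dist]
  refine integral_congr_ae (ae_of_all _ fun u => ?_)
  simp only
  rw [abs_sub_comm, abs_of_nonneg (sub_nonneg.mpr (ConvexBody.supportFun_mono h _))]

theorem totalWidth_mono {K L : KK n} (h : (K : Set (E n)) ⊆ L) : totalWidth K ≤ totalWidth L :=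
  integral_mono (integrable_supportFun K) (integrable_supportFun L)
    fun _ => ConvexBody.supportFun_mono h _

/-- The support function of `M_H K` averages that of `K` with its reflection, and the surface
measure is invariant under reflection. -/
theorem totalWidth_minkowski (H : Submodule ℝ (E n)) (K : KK n) :
    totalWidth (minkowski H K) = totalWidth K := by
  simp only [totalWidth, supportFun_minkowski]
  have hi : Integrable (fun u : Metric.sphere (0 : E n) 1 => K.supportFun (H.reflection u))
      (surfaceMeasure (E n)) :=
    integrable_sphere (K.continuous_supportFun.comp H.reflection.continuous)
  rw [integral_div, integral_add (integrable_supportFun K) hi,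
    integral_comp_sphere H.reflection K.supportFun]
  ring

theorem totalWidth_process_minkowski (H : ℕ → Submodule ℝ (E n)) (k : ℕ) (K : KK n) (j : ℕ) :
    totalWidth (process (fun m => minkowski (H m)) k K j) = totalWidth K :=
  process_induction (p := fun L => totalWidth L = totalWidth K)
    (fun _ L hL => (totalWidth_minkowski _ L).trans hL) k rfl j

theorem tendsto_l1Dist {K : ℕ → KK n} {L : KK n} (h : Tendsto K atTop (𝓝 L)) :
    Tendsto (fun m => l1Dist (K m) L) atTop (𝓝 0) := by
  have h1 : Tendsto (fun m => dist (K m) L * (surfaceMeasure (E n)).real univ) atTop (𝓝 0) := by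
    simpa using (tendsto_iff_dist_tendsto_zero.mp h).mul_const ((surfaceMeasure (E n)).real univ)
  refine squeeze_zero (fun m => integral_nonneg fun u => abs_nonneg _) (fun m => ?_) h1
  refine (integral_mono (integrable_abs_supportFun_sub _ _) (integrable_const (dist (K m) L))
    fun u => ?_).trans ?_
  · simpa using (K m).abs_supportFun_sub_le L u
  · simp [mul_comm]

/-- A bounded sequence of convex bodies which is Cauchy in `L¹` converges. -/
theorem exists_tendsto_of_l1Dist_cauchy {K : ℕ → KK n} {R : ℝ} (hR : 0 < R)
    (hK : ∀ m, ∀ x ∈ (K m : Set (E n)), ‖x‖ ≤ R)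
    (h : ∀ δ > 0, ∃ N, ∀ i ≥ N, ∀ j ≥ N, l1Dist (K i) (K j) < δ) :
    ∃ L : KK n, Tendsto K atTop (𝓝 L) := by
  refine ConvexBody.exists_tendsto_of_cauchySeq (Metric.cauchySeq_iff.mpr fun ε hε => ?_)
  -- Each support function is `R`-Lipschitz, so differences are `2 * R`-Lipschitz.
  obtain ⟨δ, hδ, hf⟩ := exists_forall_abs_le_of_integral_lt (V := E n) (R := 2 * R) (η := ε / 2)
    (by positivity) (by positivity)
  obtain ⟨N, hN⟩ := h δ hδ
  refine ⟨N, fun i hi j hj => lt_of_le_of_lt ?_ (half_lt_self hε)⟩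
  refine ConvexBody.dist_le_of_abs_supportFun_sub_le (by positivity)
    (hf (fun u => (K i).supportFun u - (K j).supportFun u)
    ((K i).continuous_supportFun.sub (K j).continuous_supportFun) (fun u v => ?_) (hN i hi j hj))
  have h1 := (K i).supportFun_sub_le_of_norm_le (hK i) u v
  have h2 := (K i).supportFun_sub_le_of_norm_le (hK i) v u
  have h3 := (K j).supportFun_sub_le_of_norm_le (hK j) u v
  have h4 := (K j).supportFun_sub_le_of_norm_le (hK j) v u
  rw [norm_sub_rev v u] at h2 h4
  exact abs_le.mpr ⟨by linarith, by linarith⟩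

theorem norm_le_of_mem_process (hT : ∀ m, IsSandwiched (H m) (T m)) (k : ℕ) {K : KK n} {R : ℝ}
    (hR : ∀ x ∈ (K : Set (E n)), ‖x‖ ≤ R) (j : ℕ) :
    ∀ x ∈ (process T k K j : Set (E n)), ‖x‖ ≤ R :=
  process_induction (p := fun L : KK n => ∀ x ∈ (L : Set (E n)), ‖x‖ ≤ R)
    (fun m L hL x hx => norm_le_of_mem_minkowski hL x ((hT m).subset_minkowski L hx)) k hR j

theorem isSandwiched_minkowski (H : Submodule ℝ (E n)) : IsSandwiched H (minkowski H) :=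
  ⟨fun _ _ hp _ hq _ => half_add_reflection_mem_minkowski H hp hq, fun _ => Subset.rfl⟩

/-! ### From Minkowski stability to sandwiched processes -/

/-- Stability for Minkowski symmetrization implies stability for every sandwiched sequence. -/
theorem isStableProcess_of_minkowski (hT : ∀ m, IsSandwiched (H m) (T m))
    (hM : IsStableProcess fun m => minkowski (H m)) : IsStableProcess T := by
  intro k K
  obtain ⟨R, hR, hKR⟩ := K.exists_norm_le
  have hb := norm_le_of_mem_process hT k hKR
  refine exists_tendsto_of_l1Dist_cauchy hR hb fun δ hδ => ?_
  have hanti : Antitone fun j => totalWidth (process T k K j) :=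
    antitone_nat_of_succ_le fun j => by
      refine (totalWidth_mono ((hT (k + (j + 1))).subset_minkowski (process T k K j))).trans ?_
      rw [totalWidth_minkowski]
  have hbdd : BddBelow (range fun j => totalWidth (process T k K j)) := by
    refine ⟨∫ _, -R ∂surfaceMeasure (E n), ?_⟩
    rintro _ ⟨j, rfl⟩
    exact integral_mono (integrable_const _) (integrable_supportFun _) fun u =>
      ConvexBody.neg_le_supportFun_of_norm_le _ (hb j) (norm_eq_of_mem_sphere u)
  have hlim := tendsto_atTop_ciInf hanti hbdd
  set w := ⨅ j, totalWidth (process T k K j)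
  have hw : ∀ j, w ≤ totalWidth (process T k K j) := fun j => ciInf_le hbdd j
  -- After time `J` less than `δ / 4` of total width can still be lost. The Minkowski process
  -- restarted there keeps its total width and contains the `T`-process, so their `L¹` distance is
  -- exactly that loss.
  obtain ⟨J, hJ⟩ := ((tendsto_order.mp hlim).2 (w + δ / 4) (by linarith)).exists
  obtain ⟨L, hL⟩ := hM (k + (J + 1)) (process T k K J)
  obtain ⟨N, hN⟩ := eventually_atTop.mp ((tendsto_order.mp (tendsto_l1Dist hL)).2 (δ / 4)
    (by positivity))
  have key : ∀ i ≥ J + 1 + N, l1Dist (process T k K i) L < δ / 2 := by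
    intro i hi
    obtain ⟨i, rfl⟩ := Nat.exists_eq_add_of_le ((Nat.le_add_right _ _).trans hi)
    have hsub := process_subset_minkowski hT (k + (J + 1)) (process T k K J) i
    rw [← process_add] at hsub
    have h1 := l1Dist_eq_of_subset hsub
    rw [totalWidth_process_minkowski] at h1
    have h2 := hN i (by omega)
    have h3 := hw (J + 1 + i)
    have h4 := l1Dist_triangle (process T k K (J + 1 + i))
      (process (fun m => minkowski (H m)) (k + (J + 1)) (process T k K J) i) L
    linarith
  refine ⟨J + 1 + N, fun i hi j hj => ?_⟩
  have h1 := l1Dist_triangle (process T k K i) L (process T k K j)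
  rw [l1Dist_comm L] at h1
  linarith [key i hi, key j hj]

/-! ### From sandwiched processes to Minkowski stability: linearization at the ball -/

/-- Minkowski symmetrization commutes with adding a ball and scaling. -/
theorem supportFun_process_unitBall_add_smul (H : ℕ → Submodule ℝ (E n)) (k : ℕ) (L : KK n)
    {ε : ℝ} (hε : 0 ≤ ε) (j : ℕ) : ∀ u : E n, ‖u‖ = 1 →
    (process (fun m => minkowski (H m)) k (ConvexBody.unitBall (E n) + ε • L) j).supportFun u =
      1 + ε * (process (fun m => minkowski (H m)) k L j).supportFun u := by
  have base : ∀ u : E n, ‖u‖ = 1 → (ConvexBody.unitBall (E n) + ε • L).supportFun u =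
      1 + ε * L.supportFun u := fun u hu => by
    rw [ConvexBody.supportFun_add, ConvexBody.supportFun_unitBall hu,
      ConvexBody.supportFun_smul _ hε]
  induction j with
  | zero =>
    intro u hu
    have hu' : ‖(H k).reflection u‖ = 1 := by simpa
    simp only [process, supportFun_minkowski, base u hu, base _ hu']
    ring
  | succ j ih =>
    intro u hu
    have hu' : ‖(H (k + (j + 1))).reflection u‖ = 1 := by simpa
    simp only [process, supportFun_minkowski, ih u hu, ih _ hu']
    ring

/-- Convexity of `t ^ d` on `t ≥ 0`, together with reflection invariance of the surface measure. -/
theorem integral_supportFun_pow_minkowski_le (H : Submodule ℝ (E n)) {K : KK n}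
    (h0 : ∀ u : E n, ‖u‖ = 1 → 0 ≤ K.supportFun u) (d : ℕ) :
    ∫ u, (minkowski H K).supportFun u ^ d ∂surfaceMeasure (E n) ≤
      ∫ u, K.supportFun u ^ d ∂surfaceMeasure (E n) := by
  have i1 : Integrable (fun u : Metric.sphere (0 : E n) 1 => K.supportFun u ^ d)
      (surfaceMeasure (E n)) := integrable_sphere (K.continuous_supportFun.pow d)
  have i2 : Integrable (fun u : Metric.sphere (0 : E n) 1 => K.supportFun (H.reflection u) ^ d)
      (surfaceMeasure (E n)) :=
    integrable_sphere ((K.continuous_supportFun.pow d).comp H.reflection.continuous)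
  calc ∫ u, (minkowski H K).supportFun u ^ d ∂surfaceMeasure (E n)
      ≤ ∫ u, (K.supportFun u ^ d + K.supportFun (H.reflection u) ^ d) / 2
          ∂surfaceMeasure (E n) := by
        refine integral_mono (integrable_sphere ((minkowski H K).continuous_supportFun.pow d))
          ((i1.add i2).div_const 2) fun u => ?_
        have h1 := h0 u (norm_eq_of_mem_sphere u)
        have h2 := h0 (H.reflection u) (by simp)
        have := (convexOn_pow d).2 h1 h2 (show (0 : ℝ) ≤ 1 / 2 by norm_num)
          (show (0 : ℝ) ≤ 1 / 2 by norm_num) (by norm_num)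
        simp only [smul_eq_mul] at this
        simp only [supportFun_minkowski]
        convert this using 1 <;> ring_nf
    _ = _ := by
        rw [integral_div, integral_add i1 i2]
        rw [integral_comp_sphere H.reflection fun u => K.supportFun u ^ d]
        ring

theorem pow_sub_pow_le_mul_of_le {a b : ℝ} (hb : 0 ≤ b) (hab : b ≤ a) (ha : a ≤ 2) (d : ℕ) :
    a ^ d - b ^ d ≤ d * 2 ^ d * (a - b) := by
  induction d with
  | zero => simp
  | succ d ih =>
    have e : a ^ (d + 1) - b ^ (d + 1) = a * (a ^ d - b ^ d) + b ^ d * (a - b) := by ring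
    have h1 : a ^ d - b ^ d ≥ 0 := sub_nonneg.mpr (pow_le_pow_left₀ hb hab d)
    have h2 : a * (a ^ d - b ^ d) ≤ 2 * (d * 2 ^ d * (a - b)) :=
      mul_le_mul ha ih h1 (by norm_num)
    have h3 : b ^ d * (a - b) ≤ 2 ^ d * (a - b) :=
      mul_le_mul_of_nonneg_right (pow_le_pow_left₀ hb (hab.trans ha) d) (sub_nonneg.mpr hab)
    have h4 : (0 : ℝ) ≤ 2 ^ d * (a - b) := mul_nonneg (by positivity) (sub_nonneg.mpr hab)
    rw [e]
    push_cast
    rw [pow_succ]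
    nlinarith

theorem half_pow_mul_le_pow_sub_pow {a b : ℝ} (hb : 1 / 2 ≤ b) (hab : b ≤ a) (d : ℕ) :
    (1 / 2) ^ d * (a - b) ≤ a ^ (d + 1) - b ^ (d + 1) := by
  have hb0 : 0 ≤ b := by linarith
  have e : a ^ (d + 1) - b ^ (d + 1) = a * (a ^ d - b ^ d) + b ^ d * (a - b) := by ring
  have h1 : 0 ≤ a * (a ^ d - b ^ d) :=
    mul_nonneg (hb0.trans hab) (sub_nonneg.mpr (pow_le_pow_left₀ hb0 hab d))
  have h2 : (1 / 2) ^ d * (a - b) ≤ b ^ d * (a - b) :=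
    mul_le_mul_of_nonneg_right (pow_le_pow_left₀ (by norm_num) hb d) (sub_nonneg.mpr hab)
  rw [e]; linarith

/-- Near the ball, the radial function falls short of the support function only to second order.
With `x ∈ L` extremal for `u`, subtracting `ε • x` leaves a component `1 - (ε R)²` along `u` and an
orthogonal one of norm at most `ε R`; by Pythagoras this vector lies in the unit ball. -/
theorem smul_mem_unitBall_add_smul {L : KK n} {R ε : ℝ} (hε : 0 ≤ ε)
    (hεR : ε * R ≤ 1 / 2) (hL : ∀ x ∈ (L : Set (E n)), ‖x‖ ≤ R) {u : E n} (hu : ‖u‖ = 1) :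
    (1 + ε * L.supportFun u - (ε * R) ^ 2) • u ∈
      (ConvexBody.unitBall (E n) + ε • L : KK n) := by
  obtain ⟨x, hx, hxu⟩ := L.exists_inner_eq_supportFun u
  have hR := hL x hx
  have hn := norm_nonneg x
  refine ⟨(1 + ε * L.supportFun u - (ε * R) ^ 2) • u - ε • x, ?_, ε • x,
    Set.smul_mem_smul_set hx, sub_add_cancel _ _⟩
  change _ ∈ ((ConvexBody.unitBall (E n) : KK n) : Set (E n))
  rw [ConvexBody.mem_unitBall, ← sq_le_one_iff₀ (norm_nonneg _), norm_sub_sq_real, norm_smul, hu,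
    real_inner_smul_left, inner_smul_right, real_inner_comm, hxu, mul_one, Real.norm_eq_abs,
    sq_abs, norm_smul, mul_pow ‖ε‖ ‖x‖, Real.norm_eq_abs ε, sq_abs]
  have h0 : 0 ≤ ε * R := mul_nonneg hε (hn.trans hR)
  have h1 : ε ^ 2 * ‖x‖ ^ 2 ≤ (ε * R) ^ 2 := by
    rw [mul_pow]; gcongr
  have h2 : (ε * R) ^ 2 ≤ 1 / 4 := by nlinarith
  nlinarith [sq_nonneg (ε * L.supportFun u), sq_nonneg (ε * R)]

theorem mem_unitBall_add_smul_of_norm_le {L : KK n} {R ε : ℝ} (hε : 0 ≤ ε)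
    (hεR : ε * R ≤ 1 / 2) (hL : ∀ x ∈ (L : Set (E n)), ‖x‖ ≤ R) (z : E n) (hz : ‖z‖ ≤ 1 / 2) :
    z ∈ ((ConvexBody.unitBall (E n) + ε • L : KK n) : Set (E n)) := by
  obtain ⟨x, hx⟩ := L.nonempty
  refine ⟨z - ε • x, ?_, ε • x, Set.smul_mem_smul_set hx, sub_add_cancel _ _⟩
  change _ ∈ ((ConvexBody.unitBall (E n) : KK n) : Set (E n))
  rw [ConvexBody.mem_unitBall]
  have h1 := norm_sub_le z (ε • x)
  rw [norm_smul, Real.norm_of_nonneg hε] at h1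
  have := mul_le_mul_of_nonneg_left (hL x hx) hε
  linarith

/-- Near the unit ball, a sandwiched process and the Minkowski process differ to second order,
uniformly in time. -/
theorem exists_l1Dist_process_le [Nontrivial (E n)] (hT : ∀ m, IsSandwiched (H m) (T m)) {R : ℝ}
    {L : KK n} (hL : ∀ x ∈ (L : Set (E n)), ‖x‖ ≤ R) :
    ∃ C : ℝ, 0 ≤ C ∧ ∀ ε : ℝ, 0 ≤ ε → ε * R ≤ 1 / 2 → ∀ k j : ℕ,
      l1Dist (process T k (ConvexBody.unitBall (E n) + ε • L) j)
        (process (fun m => minkowski (H m)) k (ConvexBody.unitBall (E n) + ε • L) j) ≤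
      C * ε ^ 2 := by
  obtain ⟨d, hd⟩ : ∃ d, Module.finrank ℝ (E n) = d + 1 :=
    Nat.exists_eq_succ_of_ne_zero Module.finrank_pos.ne'
  set σ := (surfaceMeasure (E n)).real univ with hσ
  -- The factor `2 ^ d` undoes the `(1 / 2) ^ d` coming from support functions at least `1 / 2`; the
  -- rest is a Lipschitz constant of the power `d + 1` on `[0, 2]`, times the radial defect `(ε R)²`
  -- and the area `σ`.
  refine ⟨2 ^ d * ((d + 1 : ℕ) * 2 ^ (d + 1) * R ^ 2 * σ), by positivity, fun ε hε hεR k j => ?_⟩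
  set A : KK n := ConvexBody.unitBall (E n) + ε • L with hA
  set K := process T k A j with hK
  set N := process (fun m => minkowski (H m)) k A j with hN
  have hR0 : 0 ≤ R := L.nonempty.elim fun x hx => (norm_nonneg x).trans (hL x hx)
  have hεR0 : 0 ≤ ε * R := mul_nonneg hε hR0
  have hKN : (K : Set (E n)) ⊆ N := process_subset_minkowski hT k A j
  have hAh : ∀ u : E n, ‖u‖ = 1 → A.supportFun u = 1 + ε * L.supportFun u := fun u hu => by
    rw [hA, ConvexBody.supportFun_add, ConvexBody.supportFun_unitBall hu,
      ConvexBody.supportFun_smul _ hε]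
  have habs : ∀ u : E n, ‖u‖ = 1 → -(1 / 2) ≤ ε * L.supportFun u ∧ ε * L.supportFun u ≤ 1 / 2 :=
    fun u hu => by
      have h1 := mul_le_mul_of_nonneg_left (L.supportFun_le_of_norm_le hL hu) hε
      have h2 := mul_le_mul_of_nonneg_left (L.neg_le_supportFun_of_norm_le hL hu) hε
      constructor <;> linarith
  have hball : ∀ z : E n, ‖z‖ ≤ 1 / 2 → z ∈ (A : Set (E n)) :=
    mem_unitBall_add_smul_of_norm_le hε hεR hL
  have hKball : ∀ z : E n, ‖z‖ ≤ 1 / 2 → z ∈ (K : Set (E n)) :=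
    process_induction (p := fun K : KK n => ∀ z : E n, ‖z‖ ≤ 1 / 2 → z ∈ (K : Set (E n)))
      (fun m _ hK => (hT m).ball_subset hK) k hball j
  have hKh : ∀ u : E n, ‖u‖ = 1 → 1 / 2 ≤ K.supportFun u := fun u hu => by
    have h1 := K.inner_le_supportFun (hKball ((1 / 2 : ℝ) • u) (by
      rw [norm_smul, hu, Real.norm_of_nonneg (by norm_num), mul_one])) u
    rwa [real_inner_smul_left, real_inner_self_eq_norm_sq, hu, one_pow, mul_one] at h1
  have hpowcont : ∀ M : KK n, Continuous fun u : E n => M.supportFun u ^ (d + 1) := fun M =>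
    M.continuous_supportFun.pow _
  have iK := integrable_sphere (hpowcont K)
  have iN := integrable_sphere (hpowcont N)
  have iA := integrable_sphere (hpowcont A)
  have step1 : (1 / 2) ^ d * l1Dist K N ≤
      ∫ u, N.supportFun u ^ (d + 1) ∂surfaceMeasure (E n) -
        ∫ u, K.supportFun u ^ (d + 1) ∂surfaceMeasure (E n) := by
    rw [← integral_sub iN iK, l1Dist, ← integral_const_mul]
    refine integral_mono ((integrable_abs_supportFun_sub K N).const_mul _) (iN.sub iK) fun u => ?_
    have h1 := ConvexBody.supportFun_mono hKN (u : E n)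
    simp only
    rw [abs_sub_comm, abs_of_nonneg (sub_nonneg.mpr h1)]
    exact half_pow_mul_le_pow_sub_pow (hKh u (norm_eq_of_mem_sphere u)) h1 d
  have step2 : ∫ u, N.supportFun u ^ (d + 1) ∂surfaceMeasure (E n) ≤
      ∫ u, A.supportFun u ^ (d + 1) ∂surfaceMeasure (E n) := by
    have := process_induction (T := fun m => minkowski (H m)) (p := fun M : KK n =>
      (∀ u : E n, ‖u‖ = 1 → 0 ≤ M.supportFun u) ∧
      ∫ u, M.supportFun u ^ (d + 1) ∂surfaceMeasure (E n) ≤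
        ∫ u, A.supportFun u ^ (d + 1) ∂surfaceMeasure (E n)) (fun m M hM => ⟨fun u hu => ?_,
          (integral_supportFun_pow_minkowski_le (H m) hM.1 _).trans hM.2⟩) k
      (K := A) ⟨fun u hu => ?_, le_rfl⟩ j
    · exact this.2
    · rw [supportFun_minkowski]
      have h1 := hM.1 u hu
      have h2 := hM.1 ((H m).reflection u) (by simpa)
      linarith
    · rw [hAh u hu]
      linarith [(habs u hu).1]
  have hvol : volume.real (A : Set (E n)) ≤ volume.real (K : Set (E n)) :=
    process_induction (p := fun M : KK n => volume.real (A : Set (E n)) ≤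
      volume.real (M : Set (E n))) (fun m M hM => hM.trans ((hT m).volume_le M)) k le_rfl j
  have hρ : Continuous fun u : E n => 1 + ε * L.supportFun u - (ε * R) ^ 2 :=
    (continuous_const.add (continuous_const.mul L.continuous_supportFun)).sub continuous_const
  have hsq : (ε * R) ^ 2 ≤ 1 / 4 := by nlinarith
  -- Polar coordinates bound the left side by `(d + 1) vol A`, which is at most `(d + 1) vol K` by
  -- volume growth, hence at most the right side.
  have step3 : ∫ u, (1 + ε * L.supportFun u - (ε * R) ^ 2) ^ (d + 1) ∂surfaceMeasure (E n) ≤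
      ∫ u, K.supportFun u ^ (d + 1) ∂surfaceMeasure (E n) := by
    have h1 := integral_pow_le_volume_real A hρ
      (fun u hu => by linarith [(habs u hu).1]) (hball 0 (by simp))
      (fun u hu => smul_mem_unitBall_add_smul hε hεR hL hu)
    have h2 := volume_real_le_integral_supportFun_pow K fun u hu => by linarith [hKh u hu]
    have h3 := (h1.trans hvol).trans h2
    rw [hd] at h3
    exact (div_le_div_iff_of_pos_right (by positivity)).mp h3
  have step4 : ∫ u, A.supportFun u ^ (d + 1) ∂surfaceMeasure (E n) -
      ∫ u, (1 + ε * L.supportFun u - (ε * R) ^ 2) ^ (d + 1) ∂surfaceMeasure (E n) ≤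
      (d + 1 : ℕ) * 2 ^ (d + 1) * (ε * R) ^ 2 * σ := by
    have iρ : Integrable (fun u : Metric.sphere (0 : E n) 1 =>
        (1 + ε * L.supportFun u - (ε * R) ^ 2) ^ (d + 1)) (surfaceMeasure (E n)) :=
      integrable_sphere (hρ.pow (d + 1))
    rw [← integral_sub iA iρ]
    refine (integral_mono (iA.sub iρ)
      (integrable_const ((d + 1 : ℕ) * 2 ^ (d + 1) * (ε * R) ^ 2)) fun u => ?_).trans ?_
    · have hu := norm_eq_of_mem_sphere u
      obtain ⟨h1, h2⟩ := habs u hu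
      have := pow_sub_pow_le_mul_of_le (a := 1 + ε * L.supportFun u)
        (b := 1 + ε * L.supportFun u - (ε * R) ^ 2) (by linarith)
        (by linarith [sq_nonneg (ε * R)]) (by linarith) (d + 1)
      rw [sub_sub_cancel, ← hAh u hu] at this
      simpa only [Pi.sub_apply, hAh u hu] using this
    · simp [hσ, mul_comm]
  have h5 : (1 / 2) ^ d * l1Dist K N ≤ (d + 1 : ℕ) * 2 ^ (d + 1) * (ε * R) ^ 2 * σ := by
    linarith
  have h6 : (2 : ℝ) ^ d * (1 / 2) ^ d = 1 := by rw [← mul_pow]; norm_num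
  calc l1Dist K N = 2 ^ d * ((1 / 2) ^ d * l1Dist K N) := by rw [← mul_assoc, h6, one_mul]
    _ ≤ 2 ^ d * ((d + 1 : ℕ) * 2 ^ (d + 1) * (ε * R) ^ 2 * σ) := by gcongr
    _ = _ := by ring

/-- Stability of a sandwiched sequence implies stability for Minkowski symmetrization. -/
theorem isStableProcess_minkowski_of_isSandwiched (hT : ∀ m, IsSandwiched (H m) (T m))
    (hS : IsStableProcess T) : IsStableProcess fun m => minkowski (H m) := by
  intro k L
  -- In dimension zero there is only one convex body; polar coordinates need a nontrivial space.
  rcases subsingleton_or_nontrivial (E n) with hE | hE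
  · refine ⟨L, tendsto_const_nhds.congr fun j => ConvexBody.ext ?_⟩
    exact (Subsingleton.eq_univ_of_nonempty L.nonempty).trans
      (Subsingleton.eq_univ_of_nonempty (ConvexBody.nonempty _)).symm
  obtain ⟨R, hR, hL⟩ := L.exists_norm_le
  obtain ⟨C, hC, hCε⟩ := exists_l1Dist_process_le hT hL
  refine exists_tendsto_of_l1Dist_cauchy hR
    (norm_le_of_mem_process (fun m => isSandwiched_minkowski (H m)) k hL) fun δ hδ => ?_
  -- The first bound keeps `B + εL` in the range of the second-order estimate, the second gives `C ε
  -- ≤ δ / 4`; `C + 1` guards against `C = 0`.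
  set ε := min (1 / (2 * R)) (δ / (4 * (C + 1))) with hεdef
  have hε : 0 < ε := by positivity
  have hεR : ε * R ≤ 1 / 2 := by
    calc ε * R ≤ 1 / (2 * R) * R := by gcongr; exact min_le_left _ _
      _ = 1 / 2 := by field_simp
  have hεC : C * ε ≤ δ / 4 := by
    calc C * ε ≤ (C + 1) * (δ / (4 * (C + 1))) := by
          gcongr
          · linarith
          · exact min_le_right _ _
      _ = δ / 4 := by field_simp
  set A : KK n := ConvexBody.unitBall (E n) + ε • L with hA
  obtain ⟨K, hK⟩ := hS k A
  obtain ⟨N, hN⟩ := eventually_atTop.mp ((tendsto_order.mp (tendsto_l1Dist hK)).2 (ε * δ / 4)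
    (by positivity))
  have hscale : ∀ i j : ℕ, l1Dist (process (fun m => minkowski (H m)) k A i)
      (process (fun m => minkowski (H m)) k A j) =
      ε * l1Dist (process (fun m => minkowski (H m)) k L i)
        (process (fun m => minkowski (H m)) k L j) := by
    intro i j
    rw [l1Dist, l1Dist, ← integral_const_mul]
    refine integral_congr_ae (ae_of_all _ fun u => ?_)
    simp only
    rw [supportFun_process_unitBall_add_smul H k L hε.le i u (norm_eq_of_mem_sphere u),
      supportFun_process_unitBall_add_smul H k L hε.le j u (norm_eq_of_mem_sphere u),
      add_sub_add_left_eq_sub, ← mul_sub, abs_mul, abs_of_pos hε]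
  -- The error is `C ε² ≤ ε δ / 4` from comparing the processes, plus less than `ε δ / 4` from
  -- convergence of the `T`-process; the common factor `ε` cancels against `hscale`.
  have near : ∀ i ≥ N, l1Dist (process (fun m => minkowski (H m)) k A i) K < ε * (δ / 2) := by
    intro i hi
    have h1 := l1Dist_triangle (process (fun m => minkowski (H m)) k A i) (process T k A i) K
    rw [l1Dist_comm _ (process T k A i)] at h1
    have h2 := hCε ε hε.le hεR k i
    have h3 := hN i hi
    have h4 := mul_le_mul_of_nonneg_left hεC hε.le
    nlinarith
  refine ⟨N, fun i hi j hj => ?_⟩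
  have h1 := l1Dist_triangle (process (fun m => minkowski (H m)) k A i) K
    (process (fun m => minkowski (H m)) k A j)
  rw [l1Dist_comm K, hscale] at h1
  have h2 := near i hi
  have h3 := near j hj
  refine lt_of_mul_lt_mul_left (a := ε) ?_ hε.le
  linarith

theorem isStableProcess_iff_minkowski (hT : ∀ m, IsSandwiched (H m) (T m)) :
    IsStableProcess T ↔ IsStableProcess fun m => minkowski (H m) :=
  ⟨isStableProcess_minkowski_of_isSandwiched hT, isStableProcess_of_minkowski hT⟩

end SymmProc

theorem theorem1 (n : ℕ) :
    -- A sequence that is stable for one member of `ℱ` is stable for all members of `ℱ`.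
    (∀ D ∈ SymmProc.familyF n, ∀ H : ℕ → Submodule ℝ (SymmProc.E n), SymmProc.IsStable D H →
      ∀ S ∈ SymmProc.familyF n, SymmProc.IsStable S H) ∧
    -- For hyperplanes, Steiner symmetrization can be added to the list.
    (∀ (H : ℕ → Submodule ℝ (SymmProc.E n)) (hH : ∀ m, Module.finrank ℝ (H m) + 1 = n),
      (SymmProc.IsStableProcess (fun m => SymmProc.steiner (H m) (hH m)) ↔
        SymmProc.IsStableProcess (fun m => SymmProc.minkowski (H m))) ∧
      ∀ D ∈ SymmProc.familyF n,
        (SymmProc.IsStableProcess (fun m => SymmProc.steiner (H m) (hH m)) ↔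
          SymmProc.IsStable D H)) := by
  have key : ∀ D ∈ SymmProc.familyF n, ∀ H : ℕ → Submodule ℝ (SymmProc.E n),
      SymmProc.IsStable D H ↔ SymmProc.IsStableProcess fun m => SymmProc.minkowski (H m) :=
    fun D hD H => SymmProc.isStableProcess_iff_minkowski fun m =>
      SymmProc.isSandwiched_of_mem_familyF hD (H m)
  have steiner_iff := fun (H : ℕ → Submodule ℝ (SymmProc.E n))
      (hH : ∀ m, Module.finrank ℝ (H m) + 1 = n) =>
    SymmProc.isStableProcess_iff_minkowski fun m => SymmProc.isSandwiched_steiner (H m) (hH m)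
  exact ⟨fun D hD H h S hS => (key S hS H).mpr ((key D hD H).mp h),
    fun H hH => ⟨steiner_iff H hH, fun D hD => (steiner_iff H hH).trans (key D hD H).symm⟩⟩
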